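/- Let $(\mathsf X,\mathcal X)$ be a measurable space, $M$ a Markov transition kernel and $\chi$ a probability measure on it, and $\{g_z : z\in\mathsf Z\}$ a family of real-valued measurable functions (potentials) on $\mathsf X$ with $g_z(x)>0$ for all $(x,z)$ and $\sup_x g_z(x)<\infty$ for each $z$. For a sequence $(z_n)_{n\ge 0}$ in $\mathsf Z$ and $k\le m$ let $$L_{k,m}(x_k,A)=\int\!\cdots\!\int \mathbf 1_A(x_m)\prod_{\ell=k}^{m-1} g_{z_\ell}(x_\ell)\,M(x_\ell,\mathrm d x_{\ell+1}),\qquad L_{k,k}(x,A)=\delta_x(A),$$ and let $\eta_m(A)=\chi L_{0,m}\mathbf 1_A/\chi L_{0,m}\mathbf 1_{\mathsf X}$ (so $\eta_0=\chi$). For $0\le \ell\le n$ and bounded measurable $h$ let $$\sigma^2_{n,\ell}(h)=\sum_{m=\ell}^{n}\frac{\eta_m\{L_{m,n}(h-\eta_n h)\}^2}{(\eta_m L_{m,n}\mathbf 1_{\mathsf X})^2}.$$ For every $N\ge1$ let particles $\xi_m^i$ ($0\le m\le n$) and indices $I_m^i$ ($1\le m\le n$), $i\in\{1,\dots,N\}$,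 all defined on a common probability space, be generated by the sequential Monte Carlo algorithm: $\xi_0^1,\dots,\xi_0^N$ are i.i.d. with law $\chi$; given all particles and indices up to time $m<n$, the pairs $(I_{m+1}^i,\xi_{m+1}^i)$, $i=1,\dots,N$, are conditionally independent, with $I_{m+1}^i=j$ with probability $g_{z_m}(\xi_m^j)/\sum_{\ell=1}^N g_{z_m}(\xi_m^\ell)$ and, given $I_{m+1}^i$, $\xi_{m+1}^i\sim M(\xi_m^{I_{m+1}^i},\cdot)$. Define the Enoch indices by $E_{m,m}^i=i$ and $E_{m,k}^i=E_{m,k-1}^{I_k^i}$ for $k>m$. For $\lambda\in\mathbb N$ put $n\langle\lambda\rangle=(n-\lambda)\vee0$ and $$\hat\sigma^2_{N,n,\lambda}(h)=\frac1N\sum_{i=1}^N\Bigg(\sum_{j:\,E_{n\langle\lambda\rangle,n}^j=i}\Big\{h(\xi_n^j)-\frac1N\sum_{k=1}^N h(\xi_n^k)\Big\}\Bigg)^2 .$$ Then for all $n\in\mathbb N$, all $(z_m)_{m\ge 0}$ in $\mathsf Z$, all $\lambda\in\mathbb N$ and all bounded measurable $h:\mathsf X\to\mathbb R$, as $N\to\infty$,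 $$\hat\sigma^2_{N,n,\lambda}(h)\ \stackrel{\mathbb P}{\longrightarrow}\ \sigma^2_{n,\,n\langle\lambda\rangle}(h).$$ -/

import Mathlib

open MeasureTheory ProbabilityTheory Filter

namespace SMC

noncomputable section

/-! Randomly perturbed Feynman-Kac models.  A vector of perturbations with indices
`k, ..., m - 1` is encoded by the whole sequence `z : ℕ → Z` and the end points `k` and `m`. -/

/-- The one-step unnormalised kernel `L⟨z⟩(x, dy) = g⟨z⟩(x) M(x, dy)` for the potential `g⟨z⟩ = pot`. -/
def stepKernel {X : Type*} [MeasurableSpace X] (M : Kernel X X) [IsMarkovKernel M]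
    (pot : X → ℝ) : Kernel X X :=
  M.withDensity (fun x _ => ENNReal.ofReal (pot x))

/-- The composition of the `j` one-step kernels with perturbations `z k, ..., z (k + j - 1)`. -/
def iterKernel {X Z : Type*} [MeasurableSpace X] (M : Kernel X X) [IsMarkovKernel M]
    (g : Z → X → ℝ) (z : ℕ → Z) (k : ℕ) : ℕ → Kernel X X
  | 0 => Kernel.id
  | j + 1 => stepKernel M (g (z (k + j))) ∘ₖ iterKernel M g z k j

/-- The unnormalised transition kernel with perturbations `z k, ..., z (m - 1)`; it is the
identity kernel `x ↦ δ_x` if `m ≤ k`. -/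
def unnormKernel {X Z : Type*} [MeasurableSpace X] (M : Kernel X X) [IsMarkovKernel M]
    (g : Z → X → ℝ) (z : ℕ → Z) (k m : ℕ) : Kernel X X :=
  iterKernel M g z k (m - k)

/-- The Feynman-Kac distribution at time `n`, i.e. the normalisation of `χ L⟨z_0, ..., z_{n-1}⟩`;
it is `χ` for `n = 0`. -/
def predictor {X Z : Type*} [MeasurableSpace X] (M : Kernel X X) [IsMarkovKernel M]
    (χ : Measure X) (g : Z → X → ℝ) (z : ℕ → Z) (n : ℕ) : Measure X :=
  ((χ.bind (unnormKernel M g z 0 n)) Set.univ)⁻¹ • χ.bind (unnormKernel M g z 0 n)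

/-- The asymptotic variance at time `n`, truncated to the terms `m = ℓ, ..., n`. -/
def asymptoticVariance {X Z : Type*} [MeasurableSpace X] (M : Kernel X X) [IsMarkovKernel M]
    (χ : Measure X) (g : Z → X → ℝ) (z : ℕ → Z) (n ℓ : ℕ) (h : X → ℝ) : ℝ :=
  ∑ m ∈ Finset.Icc ℓ n,
    (∫ x, (∫ y, (h y - ∫ u, h u ∂(predictor M χ g z n)) ∂(unnormKernel M g z m n x)) ^ 2
        ∂(predictor M χ g z m)) /
      (((predictor M χ g z m).bind (unnormKernel M g z m n)).real Set.univ) ^ 2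

/-! The particle system.  `ξ m i` is the `i`-th particle at time `m`, and, for `m ≥ 1`, `I m i` is
the index of its parent at time `m - 1`. -/

/-- The σ-field generated by the particles at times `0, ..., m` and the parent indices at times
`1, ..., m`. -/
abbrev history {X Ω : Type*} [MeasurableSpace X] {N : ℕ}
    (ξ : ℕ → Fin N → Ω → X) (I : ℕ → Fin N → Ω → Fin N) (m : ℕ) : MeasurableSpace Ω :=
  (⨆ k ∈ Finset.Icc 0 m, ⨆ i, MeasurableSpace.comap (ξ k i) inferInstance) ⊔
    (⨆ k ∈ Finset.Icc 1 m, ⨆ i, MeasurableSpace.comap (I k i) inferInstance)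

/-- `(ξ, I)` is the output, up to time `n`, of the sequential Monte Carlo algorithm with `N`
particles: the initial particles are i.i.d. with law `χ` and, given the history up to time
`m < n`, the pairs `(I (m + 1) i, ξ (m + 1) i)`, `i : Fin N`, are conditionally independent,
where the parent index is drawn with probabilities proportional to the weights
`g⟨z m⟩ (ξ m ℓ)` and the particle is then drawn from `M (ξ m (I (m + 1) i), ·)`. -/
structure IsParticleSystem {X Z Ω : Type*} [MeasurableSpace X] [MeasurableSpace Ω]
    (P : Measure Ω) (M : Kernel X X) (χ : Measure X) (g : Z → X → ℝ) (z : ℕ → Z) (n : ℕ)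
    {N : ℕ} (ξ : ℕ → Fin N → Ω → X) (I : ℕ → Fin N → Ω → Fin N) : Prop where
  measurable_particle : ∀ m ≤ n, ∀ i, Measurable (ξ m i)
  measurable_index : ∀ m ∈ Finset.Icc 1 n, ∀ i, Measurable (I m i)
  init : P.map (fun ω i => ξ 0 i ω) = Measure.pi (fun _ : Fin N => χ)
  update : ∀ m < n, ∀ A : Set Ω, MeasurableSet[history ξ I m] A →
    ∀ (a : Fin N → Fin N) (B : Fin N → Set X), (∀ i, MeasurableSet (B i)) →
      P (A ∩ ⋂ i, {ω | I (m + 1) i ω = a i ∧ ξ (m + 1) i ω ∈ B i}) =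
        ∫⁻ ω in A, ∏ i,
          ENNReal.ofReal (g (z m) (ξ m (a i) ω) / ∑ ℓ, g (z m) (ξ m ℓ ω)) *
            M (ξ m (a i) ω) (B i) ∂P

/-- The Enoch indices: `enoch I m n i` is the index of the ancestor at time `m` of the `i`-th
particle at time `n ≥ m` (the value for `n < m` is irrelevant). -/
def enoch {N : ℕ} (I : ℕ → Fin N → Fin N) (m : ℕ) : ℕ → Fin N → Fin N
  | 0, i => i
  | n + 1, i => if n + 1 ≤ m then i else enoch I m n (I (n + 1) i)

/-- The integral of `h` with respect to the empirical measure of the sample `x`. -/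
def particleMean {X : Type*} {N : ℕ} (x : Fin N → X) (h : X → ℝ) : ℝ :=
  (1 / (N : ℝ)) * ∑ i, h (x i)

/-- The fixed-lag variance estimator at time `n`; `n - lag` is the truncated subtraction
`max (n - lag) 0`. -/
def fixedLagEstimator {X : Type*} {N : ℕ} (x : ℕ → Fin N → X) (I : ℕ → Fin N → Fin N)
    (n lag : ℕ) (h : X → ℝ) : ℝ :=
  (1 / (N : ℝ)) * ∑ i, (∑ j with enoch I (n - lag) n j = i,
    (h (x n j) - particleMean (x n) h)) ^ 2

end

end SMC

/-! ### Second moments of i.i.d. averages and of same-block pair sums. -/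

open Topology

/-! Label each particle at time m ≥ ℓ with its ancestor at time ℓ = n - lag, and let V_m(f) be N⁻¹
times the sum, over labels, of the squared sum of f over the particles carrying that label
(`blockVariance`). The estimator is V_n applied to h minus its empirical mean. Expanding the squares
(`blockVariance_eq`), V_{m+1}(f) is the empirical mean of f² plus N⁻¹ times a sum over ordered pairs
of distinct particles with equal labels. Given the labelled population at time m, the labelled
offspring are i.i.d., and the conditional mean of the second term is (1 - 1/N) V_m(Qf) / (empirical
mean of g)², where Qf = g · Mf. In the limit this is exactly the recursion of the truncated
asymptotic variance (`limitVariance_succ`), so convergence follows by induction on m once the pair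
sum is known to concentrate around its conditional mean.

Concentration is the crux. The conditional variance is at most 4C⁴(N q₃ + q₂) by
`integral_sq_offDiag_le`, where q_r sums over labels the r-th power of the conditional probability
that an offspring carries the label. Now N q₂ = V_m(g) / (empirical mean of g)², which converges by
the induction hypothesis applied to the potential itself, and q₃ ≤ q₂^{3/2}; hence the bound tends
to 0 in probability. A conditional Chebyshev inequality
(`tendstoInMeasure_zero_of_integral_sq_kernel_le`) concludes the step. The same scheme gives the
weak law for empirical means (`tendstoInMeasure_particleMean`).

Finally V_n is a quadratic form, so exchanging the limiting mean for the empirical one changes it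
only by terms that vanish (`blockVariance_sub`). -/

theorem integral_sq_average_sub_le {S ι : Type*} [MeasurableSpace S] [Fintype ι] [Nonempty ι]
    (μ : Measure S) [IsProbabilityMeasure μ] {f : S → ℝ} (hf : Measurable f) {C : ℝ}
    (hC : ∀ x, |f x| ≤ C) :
    ∫ y : ι → S, ((1 / (Fintype.card ι : ℝ)) * ∑ i, f (y i) - ∫ x, f x ∂μ) ^ 2
      ∂(Measure.pi fun _ => μ) ≤ C ^ 2 / Fintype.card ι := by
  have hL : MemLp f 2 μ := MemLp.of_bound hf.aestronglyMeasurable C (ae_of_all _ hC)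
  have hmp (i : ι) : MeasurePreserving (fun y : ι → S => y i) (Measure.pi fun _ => μ) μ :=
    measurePreserving_eval (fun _ : ι => μ) i
  have hN : (0 : ℝ) < Fintype.card ι := by exact_mod_cast Fintype.card_pos
  have hv := variance_sum_pi (μ := fun _ : ι => μ) (X := fun _ => f) (fun _ => hL)
  have hint (i : ι) : Integrable (fun y : ι → S => f (y i)) (Measure.pi fun _ => μ) :=
    (hmp i).integrable_comp_of_integrable (hL.integrable one_le_two)
  have hE (i : ι) : ∫ y : ι → S, f (y i) ∂(Measure.pi fun _ => μ) = ∫ x, f x ∂μ := by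
    have := (hmp i).map_eq
    rw [← this, integral_map (hmp i).measurable.aemeasurable (by
      rw [this]; exact hf.aestronglyMeasurable), this]
  have hvar : Var[f; μ] ≤ C ^ 2 := by
    refine (variance_le_expectation_sq hf.aestronglyMeasurable).trans ?_
    calc ∫ x, (f ^ 2) x ∂μ ≤ ∫ _, C ^ 2 ∂μ := by
          refine integral_mono hL.integrable_sq (integrable_const _) fun x => ?_
          simpa using sq_le_sq' (abs_le.1 (hC x)).1 (abs_le.1 (hC x)).2
      _ = C ^ 2 := by simp
  rw [variance_eq_integral (by fun_prop)] at hv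
  simp only [Finset.sum_apply] at hv
  rw [integral_finsetSum _ (fun i _ => hint i)] at hv
  simp only [hE, Finset.sum_const, Finset.card_univ, nsmul_eq_mul] at hv
  have : ∀ y : ι → S, ((1 / (Fintype.card ι : ℝ)) * ∑ i, f (y i) - ∫ x, f x ∂μ) ^ 2 =
      (1 / (Fintype.card ι : ℝ)) ^ 2 *
        (∑ i, f (y i) - (Fintype.card ι : ℝ) * ∫ x, f x ∂μ) ^ 2 := by
    intro y; field_simp
  simp_rw [this]
  rw [integral_const_mul, hv]
  field_simp
  exact hvar

/-- The product `f x * f y` if `x` and `y` lie in the same block of the partition `b`, and `0`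
otherwise. -/
noncomputable def blockProd {S E : Type*} [DecidableEq E] (b : S → E) (f : S → ℝ) (x y : S) : ℝ :=
  if b x = b y then f x * f y else 0

section blockProd

variable {S E ι : Type*} [MeasurableSpace S] [Fintype ι] [DecidableEq ι]
  [Fintype E] [DecidableEq E] [MeasurableSpace E] [MeasurableSingletonClass E]
  {b : S → E} {f : S → ℝ} {C : ℝ}

omit [MeasurableSpace S] [Fintype E] [MeasurableSpace E] [MeasurableSingletonClass E] in
theorem abs_blockProd_le (hC : ∀ x, |f x| ≤ C) (x y : S) : |blockProd b f x y| ≤ C ^ 2 := by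
  have h0 : 0 ≤ C := (abs_nonneg _).trans (hC x)
  unfold blockProd
  split_ifs
  · rw [abs_mul, sq]; exact mul_le_mul (hC x) (hC y) (abs_nonneg _) h0
  · simpa using sq_nonneg C

theorem measurable_blockProd (hb : Measurable b) (hf : Measurable f) :
    Measurable fun p : S × S => blockProd b f p.1 p.2 := by
  unfold blockProd
  refine Measurable.ite ?_ (by fun_prop) (by fun_prop)
  exact measurableSet_eq_fun (hb.comp measurable_fst) (hb.comp measurable_snd)

-- Splitting the kernel into products of functions of one variable lets independence factor its
-- mean.
omit [MeasurableSpace S] [MeasurableSpace E] [MeasurableSingletonClass E] in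
theorem blockProd_eq_sum (x y : S) :
    blockProd b f x y =
      ∑ e, (b ⁻¹' {e}).indicator f x * (b ⁻¹' {e}).indicator f y := by
  have h (e : E) (x : S) : (b ⁻¹' {e}).indicator f x = if b x = e then f x else 0 := by
    by_cases hx : b x = e <;> simp [hx]
  simp only [h, blockProd, ite_mul, zero_mul, mul_ite, mul_zero, Finset.sum_ite_eq,
    Finset.mem_univ, if_true]

-- Union bound over the common block; for a fixed block the event is a box, with one factor per
-- coordinate in `T`.
omit [DecidableEq E] [MeasurableSpace E] [MeasurableSingletonClass E] in
theorem measureReal_pi_block_le (μ : Measure S) [IsProbabilityMeasure μ] (b : S → E)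
    (T : Finset ι) (hT : T.Nonempty) :
    (Measure.pi fun _ : ι => μ).real {y | ∀ i ∈ T, ∀ k ∈ T, b (y i) = b (y k)} ≤
      ∑ e, μ.real (b ⁻¹' {e}) ^ T.card := by
  obtain ⟨i₀, hi₀⟩ := hT
  have hsub : {y : ι → S | ∀ i ∈ T, ∀ k ∈ T, b (y i) = b (y k)} ⊆
      ⋃ e, Set.univ.pi fun i => if i ∈ T then b ⁻¹' {e} else Set.univ := by
    intro y hy
    refine Set.mem_iUnion.2 ⟨b (y i₀), fun i _ => ?_⟩
    by_cases hi : i ∈ T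
    · simpa [hi] using hy i hi i₀ hi₀
    · simp [hi]
  refine (measureReal_mono hsub).trans ((measureReal_iUnion_fintype_le _).trans ?_)
  refine Finset.sum_le_sum fun e _ => le_of_eq ?_
  rw [measureReal_def, Measure.pi_pi, ENNReal.toReal_prod]
  simp only [apply_ite μ, measure_univ, apply_ite ENNReal.toReal, ENNReal.toReal_one]
  rw [Finset.prod_ite_mem]
  simp [measureReal_def]

omit [DecidableEq ι] in
theorem integral_blockProd_pi (μ : Measure S) [IsProbabilityMeasure μ] (hb : Measurable b)
    (hf : Measurable f) (hC : ∀ x, |f x| ≤ C) {j k : ι} (hjk : j ≠ k) :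
    ∫ y : ι → S, blockProd b f (y j) (y k) ∂(Measure.pi fun _ => μ) =
      ∑ e, (∫ x in b ⁻¹' {e}, f x ∂μ) ^ 2 := by
  have hm (e : E) : Measurable ((b ⁻¹' {e}).indicator f) :=
    hf.indicator (hb (measurableSet_singleton e))
  have hCi (e : E) (x : S) : |(b ⁻¹' {e}).indicator f x| ≤ C := by
    by_cases h : x ∈ b ⁻¹' {e}
    · simpa [h] using hC x
    · simpa [Set.indicator_of_notMem h] using (abs_nonneg _).trans (hC x)
  have hind := (iIndepFun_pi (μ := fun _ : ι => μ) (X := fun _ => id)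
    (fun _ => aemeasurable_id)).indepFun hjk
  have hE (e : E) (i : ι) : ∫ y : ι → S, (b ⁻¹' {e}).indicator f (y i) ∂(Measure.pi fun _ => μ) =
      ∫ x in b ⁻¹' {e}, f x ∂μ := by
    have := (measurePreserving_eval (fun _ : ι => μ) i).map_eq
    rw [← integral_indicator (hb (measurableSet_singleton e)), ← this,
      integral_map (measurable_pi_apply i).aemeasurable (by
        rw [this]; exact (hm e).aestronglyMeasurable), this]
  simp_rw [blockProd_eq_sum]
  rw [integral_finsetSum]
  · refine Finset.sum_congr rfl fun e _ => ?_
    have h2 := (hind.comp (hm e) (hm e)).integral_fun_mul_eq_mul_integral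
      ((hm e).comp (measurable_pi_apply j)).aestronglyMeasurable
      ((hm e).comp (measurable_pi_apply k)).aestronglyMeasurable
    simp only [Function.comp_apply, id, hE] at h2
    rw [sq, ← h2]
  · intro e _
    refine Integrable.of_bound (C := C * C) (((hm e).comp (measurable_pi_apply j)).mul
      ((hm e).comp (measurable_pi_apply k))).aestronglyMeasurable (ae_of_all _ fun y => ?_)
    rw [Real.norm_eq_abs, abs_mul]
    exact mul_le_mul (hCi e _) (hCi e _) (abs_nonneg _) ((abs_nonneg _).trans (hCi e (y j)))

/-- The integrand is at most `C ^ 4` and vanishes unless both pairs are matched, which puts all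
coordinates of `T` in one block. -/
theorem integral_blockProd_mul_le (μ : Measure S) [IsProbabilityMeasure μ] (hb : Measurable b)
    (hf : Measurable f) (hC : ∀ x, |f x| ≤ C) {j k j' k' : ι} (T : Finset ι) (hT : T.Nonempty)
    (hsub : ∀ y : ι → S, b (y j) = b (y k) → b (y j') = b (y k') →
      ∀ i ∈ T, ∀ l ∈ T, b (y i) = b (y l)) :
    ∫ y : ι → S, blockProd b f (y j) (y k) * blockProd b f (y j') (y k')
      ∂(Measure.pi fun _ => μ) ≤ C ^ 4 * ∑ e, μ.real (b ⁻¹' {e}) ^ T.card := by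
  have hK := measurable_blockProd hb hf
  have hKm (j k : ι) : Measurable fun y : ι → S => blockProd b f (y j) (y k) :=
    hK.comp (f := fun y : ι → S => (y j, y k)) (by fun_prop)
  set D : Set (ι → S) := {y | b (y j) = b (y k) ∧ b (y j') = b (y k')} with hD
  have hDm : MeasurableSet D :=
    (measurableSet_eq_fun (by fun_prop) (by fun_prop)).inter
      (measurableSet_eq_fun (by fun_prop) (by fun_prop))
  have hC4 : 0 ≤ C ^ 4 := by positivity
  calc _ ≤ ∫ y : ι → S, D.indicator (fun _ => C ^ 4) y ∂(Measure.pi fun _ => μ) := by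
        refine integral_mono ?_ ((integrable_const _).indicator hDm) fun y => ?_
        · refine Integrable.of_bound (C := C ^ 2 * C ^ 2)
            ((hKm j k).mul (hKm j' k')).aestronglyMeasurable (ae_of_all _ fun y => ?_)
          rw [Real.norm_eq_abs, abs_mul]
          exact mul_le_mul (abs_blockProd_le hC _ _) (abs_blockProd_le hC _ _) (abs_nonneg _)
            (sq_nonneg _)
        · by_cases hy : y ∈ D
          · simp only [Set.indicator_of_mem hy]
            refine (le_abs_self _).trans ?_
            rw [abs_mul, show C ^ 4 = C ^ 2 * C ^ 2 by ring]
            exact mul_le_mul (abs_blockProd_le hC _ _) (abs_blockProd_le hC _ _) (abs_nonneg _)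
              (sq_nonneg _)
          · simp only [Set.indicator_of_notMem hy]
            simp only [hD, Set.mem_ofPred_eq, not_and_or] at hy
            rcases hy with h | h <;> simp [blockProd, h]
    _ = C ^ 4 * (Measure.pi fun _ : ι => μ).real D := by
        rw [integral_indicator_const _ hDm]; simp [mul_comm]
    _ ≤ _ := by
        gcongr
        refine (measureReal_mono fun y hy => ?_).trans (measureReal_pi_block_le μ b T hT)
        exact hsub y hy.1 hy.2

/-- Expand the square into covariances indexed by two ordered pairs. Disjoint pairs are independent
and contribute nothing; pairs sharing one index force three coordinates into one block (order N³
terms of size q₃), and pairs sharing both force two (order N² terms of size q₂). The prefactor 1/N²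
leaves N q₃ + q₂. -/
theorem integral_sq_offDiag_le (μ : Measure S) [IsProbabilityMeasure μ] [Nonempty ι]
    (hb : Measurable b) (hf : Measurable f) (hC : ∀ x, |f x| ≤ C) :
    ∫ y : ι → S, ((1 / (Fintype.card ι : ℝ)) *
        ∑ p ∈ Finset.univ.offDiag, blockProd b f (y p.1) (y p.2) -
          ((Fintype.card ι : ℝ) - 1) * ∑ e, (∫ x in b ⁻¹' {e}, f x ∂μ) ^ 2) ^ 2
      ∂(Measure.pi fun _ => μ) ≤
    4 * C ^ 4 * (Fintype.card ι * ∑ e, μ.real (b ⁻¹' {e}) ^ 3 + ∑ e, μ.real (b ⁻¹' {e}) ^ 2) := by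
  set N : ℝ := (Fintype.card ι : ℝ) with hNdef
  have hN : 0 < N := by simp only [hNdef]; exact_mod_cast Fintype.card_pos
  set θ : ℝ := ∑ e, (∫ x in b ⁻¹' {e}, f x ∂μ) ^ 2 with hθ
  set q₃ : ℝ := ∑ e, μ.real (b ⁻¹' {e}) ^ 3 with hq3
  set q₂ : ℝ := ∑ e, μ.real (b ⁻¹' {e}) ^ 2 with hq2
  have hq3n : 0 ≤ q₃ := Finset.sum_nonneg fun _ _ => by positivity
  have hq2n : 0 ≤ q₂ := Finset.sum_nonneg fun _ _ => by positivity
  have hC4 : 0 ≤ C ^ 4 := by positivity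
  let K : ι × ι → (ι → S) → ℝ := fun p y => blockProd b f (y p.1) (y p.2)
  have hKm (p : ι × ι) : Measurable (K p) :=
    (measurable_blockProd hb hf).comp (f := fun y : ι → S => (y p.1, y p.2)) (by fun_prop)
  have hKb (p : ι × ι) (y : ι → S) : |K p y| ≤ C ^ 2 := abs_blockProd_le hC _ _
  have hKi (p : ι × ι) : Integrable (K p) (Measure.pi fun _ => μ) :=
    Integrable.of_bound (C := C ^ 2) (hKm p).aestronglyMeasurable (ae_of_all _ (hKb p))
  have hKKi (p p' : ι × ι) : Integrable (fun y => K p y * K p' y) (Measure.pi fun _ => μ) := by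
    refine Integrable.of_bound (C := C ^ 2 * C ^ 2)
      ((hKm p).mul (hKm p')).aestronglyMeasurable (ae_of_all _ fun y => ?_)
    rw [Real.norm_eq_abs, abs_mul]
    exact mul_le_mul (hKb p y) (hKb p' y) (abs_nonneg _) (sq_nonneg _)
  have hKE (p : ι × ι) (hp : p.1 ≠ p.2) : ∫ y, K p y ∂(Measure.pi fun _ => μ) = θ :=
    integral_blockProd_pi μ hb hf hC hp
  have hcov (p p' : ι × ι) (hp : p.1 ≠ p.2) (hp' : p'.1 ≠ p'.2) :
      ∫ y, (K p y - θ) * (K p' y - θ) ∂(Measure.pi fun _ => μ) =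
        ∫ y, K p y * K p' y ∂(Measure.pi fun _ => μ) - θ ^ 2 := by
    have : ∀ y, (K p y - θ) * (K p' y - θ) = K p y * K p' y - θ * K p y - θ * K p' y + θ ^ 2 :=
      fun y => by ring
    simp_rw [this]
    have h1 : Integrable (fun y => K p y * K p' y - θ * K p y) (Measure.pi fun _ => μ) :=
      (hKKi p p').sub ((hKi p).const_mul θ)
    have h2 : Integrable (fun y => K p y * K p' y - θ * K p y - θ * K p' y)
      (Measure.pi fun _ => μ) := h1.sub ((hKi p').const_mul θ)
    rw [integral_add h2 (integrable_const _), integral_sub h1 ((hKi p').const_mul θ),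
      integral_sub (hKKi p p') ((hKi p).const_mul θ), integral_const_mul, integral_const_mul,
      hKE p hp, hKE p' hp']
    simp
    ring
  -- A majorant with one summand for each of the four ways an index of `p'` can equal one of `p`. It
  -- overcounts, but each summand totals N³ q₃ + N² q₂ over all pairs, hence the constant 4.
  let β : ι × ι → ι × ι → ℝ := fun p p' =>
    (if p'.1 = p.1 then q₃ + (if p'.2 = p.2 then q₂ else 0) else 0) +
    (if p'.1 = p.2 then q₃ + (if p'.2 = p.1 then q₂ else 0) else 0) +
    (if p'.2 = p.1 then q₃ + (if p'.1 = p.2 then q₂ else 0) else 0) +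
    (if p'.2 = p.2 then q₃ + (if p'.1 = p.1 then q₂ else 0) else 0)
  have hβ0 (p p' : ι × ι) : 0 ≤ β p p' := by
    simp only [β]
    positivity
  have hbound (p p' : ι × ι) (hp : p.1 ≠ p.2) (hp' : p'.1 ≠ p'.2) :
      ∫ y, (K p y - θ) * (K p' y - θ) ∂(Measure.pi fun _ => μ) ≤ C ^ 4 * β p p' := by
    rw [hcov p p' hp hp']
    obtain ⟨j, k⟩ := p
    obtain ⟨j', k'⟩ := p'
    simp only at hp hp'
    by_cases hdis : j' ≠ j ∧ j' ≠ k ∧ k' ≠ j ∧ k' ≠ k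
    · have hind := (iIndepFun_pi (μ := fun _ : ι => μ) (X := fun _ => id)
        (fun _ => aemeasurable_id)).indepFun_prodMk_prodMk (fun i => measurable_pi_apply i)
        j k j' k' hdis.1.symm hdis.2.2.1.symm hdis.2.1.symm hdis.2.2.2.symm
      have h2 := (hind.comp (measurable_blockProd hb hf)
        (measurable_blockProd hb hf)).integral_fun_mul_eq_mul_integral
        (hKm (j, k)).aestronglyMeasurable (hKm (j', k')).aestronglyMeasurable
      have h3 : ∫ y, K (j, k) y * K (j', k') y ∂(Measure.pi fun _ => μ) =
        (∫ y, K (j, k) y ∂(Measure.pi fun _ => μ)) *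
        (∫ y, K (j', k') y ∂(Measure.pi fun _ => μ)) := h2
      rw [h3, hKE _ hp, hKE _ hp']
      have := mul_nonneg hC4 (hβ0 (j, k) (j', k'))
      linarith [sq θ]
    -- Subtracting θ² ≥ 0 only helps, so for overlapping pairs it is enough to bound the uncentred
    -- product.
    · have key : ∫ y, K (j, k) y * K (j', k') y ∂(Measure.pi fun _ => μ) ≤
          C ^ 4 * β (j, k) (j', k') := by
        have h2 : ∫ y, K (j, k) y * K (j', k') y ∂(Measure.pi fun _ => μ) ≤
            C ^ 4 * q₂ := by
          have := integral_blockProd_mul_le μ hb hf hC (j := j) (k := k) (j' := j') (k' := k')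
            {j, k} (by simp) (by
              intro y h _
              simp [h])
          rwa [Finset.card_pair hp] at this
        have h3 (l : ι) (h1 : j ≠ l) (h2 : k ≠ l) (hsub : ∀ y : ι → S, b (y j) = b (y k) →
            b (y j') = b (y k') → b (y l) = b (y k)) :
            ∫ y, K (j, k) y * K (j', k') y ∂(Measure.pi fun _ => μ) ≤ C ^ 4 * q₃ := by
          have := integral_blockProd_mul_le μ hb hf hC (j := j) (k := k) (j' := j') (k' := k')
            {j, k, l} (by simp) (by
              intro y h h'
              simp [h, hsub y h h'])
          rwa [Finset.card_eq_three.2 ⟨j, k, l, hp, h1, h2, rfl⟩] at this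
        by_cases h1 : j' = j
        · subst h1
          by_cases h2' : k' = k
          · subst h2'
            refine h2.trans (mul_le_mul_of_nonneg_left ?_ hC4)
            simp [β, hp, hp.symm]
            linarith
          · refine (h3 k' hp' (Ne.symm h2') fun y h h' => by rw [← h', h]).trans
              (mul_le_mul_of_nonneg_left ?_ hC4)
            simp [β, hp, hp'.symm, h2']
        · by_cases h2' : j' = k
          · subst h2'
            by_cases h3' : k' = j
            · subst h3'
              refine h2.trans (mul_le_mul_of_nonneg_left ?_ hC4)
              simp [β, hp, hp.symm]
              linarith
            · refine (h3 k' (Ne.symm h3') hp' fun y h h' => by rw [← h']).trans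
                (mul_le_mul_of_nonneg_left ?_ hC4)
              simp [β, hp.symm, hp'.symm, h3']
          · by_cases h3' : k' = j
            · subst h3'
              refine (h3 j' (Ne.symm h1) (Ne.symm h2') fun y h h' => by rw [h', h]).trans
                (mul_le_mul_of_nonneg_left ?_ hC4)
              simp [β, hp, h1, h2']
            · have h4' : k' = k := by
                by_contra h4'
                exact hdis ⟨h1, h2', h3', h4'⟩
              subst h4'
              refine (h3 j' (Ne.symm h1) (Ne.symm h2') fun y h h' => h').trans
                (mul_le_mul_of_nonneg_left ?_ hC4)
              simp [β, h1, h2', h3']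
      linarith [sq_nonneg θ]
  have hcard : ((Finset.univ : Finset ι).offDiag.card : ℝ) = N * N - N := by
    rw [Finset.offDiag_card, Nat.cast_sub (Nat.le_mul_self _)]
    simp [hNdef]
  -- With N² - N ordered pairs, the constant (N - 1)θ is 1/N times the sum of the means, so the
  -- centring can be distributed over the terms.
  have hexp : ∀ y : ι → S, (1 / N * ∑ p ∈ Finset.univ.offDiag, blockProd b f (y p.1) (y p.2) -
      (N - 1) * θ) ^ 2 = (1 / N) ^ 2 * ∑ p ∈ Finset.univ.offDiag, ∑ p' ∈ Finset.univ.offDiag,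
        (K p y - θ) * (K p' y - θ) := by
    intro y
    rw [← Finset.sum_mul_sum, Finset.sum_sub_distrib, Finset.sum_const, nsmul_eq_mul, hcard]
    simp only [K]
    field_simp
  simp_rw [hexp]
  have hint (p p' : ι × ι) : Integrable (fun y => (K p y - θ) * (K p' y - θ))
      (Measure.pi fun _ => μ) := by
    have : (fun y => (K p y - θ) * (K p' y - θ)) =
        fun y => K p y * K p' y - θ * K p y - θ * K p' y + θ ^ 2 := by ext y; ring
    rw [this]
    exact (((hKKi p p').sub ((hKi p).const_mul θ)).sub ((hKi p').const_mul θ)).add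
      (integrable_const _)
  rw [integral_const_mul, integral_finsetSum _ fun p _ => integrable_finsetSum _ fun p' _ =>
    hint p p']
  simp_rw [integral_finsetSum _ fun p' _ => hint _ p']
  have hsum : ∑ p ∈ Finset.univ.offDiag, ∑ p' ∈ Finset.univ.offDiag,
      ∫ y, (K p y - θ) * (K p' y - θ) ∂(Measure.pi fun _ => μ) ≤
      C ^ 4 * (4 * (N ^ 3 * q₃ + N ^ 2 * q₂)) := by
    calc _ ≤ ∑ p ∈ (Finset.univ : Finset ι).offDiag, ∑ p' ∈ (Finset.univ : Finset ι).offDiag,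
          C ^ 4 * β p p' := by
          refine Finset.sum_le_sum fun p hp => Finset.sum_le_sum fun p' hp' => hbound p p' ?_ ?_
          · exact (Finset.mem_offDiag.1 hp).2.2
          · exact (Finset.mem_offDiag.1 hp').2.2
      _ ≤ ∑ p : ι × ι, ∑ p' : ι × ι, C ^ 4 * β p p' := by
          refine (Finset.sum_le_sum fun p _ => Finset.sum_le_univ_sum_of_nonneg fun p' =>
            mul_nonneg hC4 (hβ0 p p')).trans ?_
          exact Finset.sum_le_univ_sum_of_nonneg fun p =>
            Finset.sum_nonneg fun p' _ => mul_nonneg hC4 (hβ0 p p')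
      _ = _ := by
          simp_rw [← Finset.mul_sum]
          congr 1
          simp only [β, Fintype.sum_prod_type]
          simp [Finset.sum_add_distrib, Finset.sum_ite_eq', ← hNdef]
          ring
  calc _ ≤ (1 / N) ^ 2 * (C ^ 4 * (4 * (N ^ 3 * q₃ + N ^ 2 * q₂))) := by gcongr
    _ = _ := by field_simp

end blockProd

/-- Each term is at most the ℓ² norm. This gives N q₃ ≤ (N q₂) √q₂, so control of N q₂ alone makes N
q₃ small. -/
theorem sum_pow_three_le {E : Type*} [Fintype E] (p : E → ℝ) :
    ∑ e, p e ^ 3 ≤ (∑ e, p e ^ 2) * √(∑ e, p e ^ 2) := by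
  rw [Finset.sum_mul]
  refine Finset.sum_le_sum fun e _ => ?_
  rw [pow_succ]
  gcongr
  refine Real.le_sqrt_of_sq_le ?_
  exact Finset.single_le_sum (f := fun e => p e ^ 2) (fun _ _ => sq_nonneg _) (Finset.mem_univ e)

/-! ### Convergence in probability to constants, and a conditional Chebyshev inequality. -/

namespace MeasureTheory.TendstoInMeasure

variable {Ω ι E F : Type*} [MeasurableSpace Ω] {P : Measure Ω} {l : Filter ι}
  [PseudoMetricSpace E] [PseudoMetricSpace F]

theorem continuousAt_comp_const {X : ι → Ω → E} {c : E} {φ : E → F}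
    (hX : TendstoInMeasure P X l fun _ => c) (hφ : ContinuousAt φ c) :
    TendstoInMeasure P (fun i ω => φ (X i ω)) l fun _ => φ c := by
  rw [tendstoInMeasure_iff_dist] at hX ⊢
  intro ε hε
  obtain ⟨δ, hδ, h⟩ := Metric.continuousAt_iff.1 hφ ε hε
  refine tendsto_of_tendsto_of_tendsto_of_le_of_le tendsto_const_nhds (hX δ hδ)
    (fun _ => zero_le) fun i => measure_mono fun ω hω => ?_
  by_contra hlt
  exact absurd (h (not_le.1 hlt)) (not_lt.2 hω)

theorem prodMk_const {X : ι → Ω → E} {Y : ι → Ω → F} {c : E} {d : F}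
    (hX : TendstoInMeasure P X l fun _ => c) (hY : TendstoInMeasure P Y l fun _ => d) :
    TendstoInMeasure P (fun i ω => (X i ω, Y i ω)) l fun _ => (c, d) := by
  rw [tendstoInMeasure_iff_dist] at hX hY ⊢
  intro ε hε
  have h := (hX ε hε).add (hY ε hε)
  rw [add_zero] at h
  refine tendsto_of_tendsto_of_tendsto_of_le_of_le tendsto_const_nhds h
    (fun _ => zero_le) fun i => (measure_mono fun ω hω => ?_).trans (measure_union_le _ _)
  simpa [Prod.dist_eq] using hω

theorem of_tendsto_const {u : ι → E} {c : E} (hu : Tendsto u l (𝓝 c)) :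
    TendstoInMeasure P (fun i _ => u i) l fun _ => c := by
  rw [tendstoInMeasure_iff_dist]
  intro ε hε
  refine tendsto_const_nhds.congr' ?_
  filter_upwards [Metric.tendsto_nhds.1 hu ε hε] with i hi
  simp [not_le.2 hi]

end MeasureTheory.TendstoInMeasure

/-- Chebyshev under κ(X, ·): where b(X) < δε² the conditional probability of the event is at most δ,
and elsewhere it is bounded by 1. -/
theorem measure_le_of_integral_sq_kernel_le {Ω S T : Type*} [MeasurableSpace Ω] [MeasurableSpace S]
    [MeasurableSpace T] {P : Measure Ω} [IsProbabilityMeasure P] {κ : Kernel S T} [IsMarkovKernel κ]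
    {X : Ω → S} {Y : Ω → T} (hX : Measurable X) (hY : Measurable Y)
    (hlaw : P.map (fun ω => (X ω, Y ω)) = P.map X ⊗ₘ κ) {ψ : S → T → ℝ}
    (hψ : Measurable fun p : S × T => ψ p.1 p.2) (hint : ∀ s, Integrable (fun y => ψ s y ^ 2) (κ s))
    {b : S → ℝ} (hb : ∀ s, ∫ y, ψ s y ^ 2 ∂(κ s) ≤ b s) {ε δ : ℝ} (hε : 0 < ε) :
    P {ω | ε ≤ |ψ (X ω) (Y ω)|} ≤ ENNReal.ofReal δ + P {ω | δ * ε ^ 2 ≤ b (X ω)} := by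
  have hD : MeasurableSet {p : S × T | ε ≤ |ψ p.1 p.2|} :=
    measurableSet_le measurable_const (continuous_abs.measurable.comp hψ)
  have h1 : P {ω | ε ≤ |ψ (X ω) (Y ω)|} = ∫⁻ ω, κ (X ω) {y | ε ≤ |ψ (X ω) y|} ∂P := by
    have := Measure.map_apply (hX.prodMk hY) hD (μ := P)
    rw [hlaw, Measure.compProd_apply hD, lintegral_map (Kernel.measurable_kernel_prodMk_left hD) hX]
      at this
    exact this.symm
  have h2 (s : S) (hs : b s < δ * ε ^ 2) : κ s {y | ε ≤ |ψ s y|} ≤ ENNReal.ofReal δ := by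
    have h3 := mul_meas_ge_le_integral_of_nonneg (μ := κ s) (f := fun y => ψ s y ^ 2)
      (ae_of_all _ fun y => sq_nonneg _) (hint s) (ε ^ 2)
    have h4 : (κ s).real {y | ε ^ 2 ≤ ψ s y ^ 2} ≤ δ := by
      have : ε ^ 2 * (κ s).real {y | ε ^ 2 ≤ ψ s y ^ 2} < ε ^ 2 * δ := by
        linarith [hb s]
      exact (lt_of_mul_lt_mul_left this (by positivity)).le
    have h5 : {y | ε ≤ |ψ s y|} ⊆ {y | ε ^ 2 ≤ ψ s y ^ 2} := fun y hy => by
      have : ε ≤ |ψ s y| := hy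
      simpa only [sq_abs, Set.mem_ofPred_eq] using pow_le_pow_left₀ hε.le this 2
    refine (measure_mono h5).trans ?_
    rw [← ofReal_measureReal]
    exact ENNReal.ofReal_le_ofReal h4
  rw [h1]
  calc _ ≤ ∫⁻ ω, ENNReal.ofReal δ + {ω | δ * ε ^ 2 ≤ b (X ω)}.indicator (fun _ => 1) ω ∂P := by
        refine lintegral_mono fun ω => ?_
        by_cases h : δ * ε ^ 2 ≤ b (X ω)
        · refine prob_le_one.trans ?_
          simp [h]
        · exact (h2 _ (not_le.1 h)).trans le_self_add
    _ ≤ _ := by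
        rw [lintegral_add_left measurable_const]
        gcongr
        · simp
        · exact (lintegral_indicator_const_le _ _).trans (by simp)

/-- A conditional second moment that vanishes only in probability is enough. The spaces depend on
`i` because the population space changes with its size. -/
theorem tendstoInMeasure_zero_of_integral_sq_kernel_le {Ω ι : Type*} {S T : ι → Type*}
    [MeasurableSpace Ω]
    [∀ i, MeasurableSpace (S i)] [∀ i, MeasurableSpace (T i)] {P : Measure Ω}
    [IsProbabilityMeasure P] {l : Filter ι} {κ : ∀ i, Kernel (S i) (T i)}
    [∀ i, IsMarkovKernel (κ i)] {X : ∀ i, Ω → S i} {Y : ∀ i, Ω → T i} (hX : ∀ i, Measurable (X i))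
    (hY : ∀ i, Measurable (Y i))
    (hlaw : ∀ i, P.map (fun ω => (X i ω, Y i ω)) = P.map (X i) ⊗ₘ κ i) {ψ : ∀ i, S i → T i → ℝ}
    (hψ : ∀ i, Measurable fun p : S i × T i => ψ i p.1 p.2)
    (hint : ∀ i s, Integrable (fun y => ψ i s y ^ 2) (κ i s))
    {b : ∀ i, S i → ℝ} (hb : ∀ i s, ∫ y, ψ i s y ^ 2 ∂(κ i s) ≤ b i s)
    (hb0 : TendstoInMeasure P (fun i ω => b i (X i ω)) l fun _ => 0) :
    TendstoInMeasure P (fun i ω => ψ i (X i ω) (Y i ω)) l fun _ => 0 := by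
  rw [tendstoInMeasure_iff_dist] at hb0 ⊢
  intro ε hε
  simp only [Real.dist_eq, sub_zero] at hb0 ⊢
  rw [ENNReal.tendsto_nhds_zero]
  intro η hη
  obtain ⟨δ, hδ, hδη⟩ : ∃ δ : ℝ, 0 < δ ∧ ENNReal.ofReal δ + ENNReal.ofReal δ ≤ η := by
    rcases eq_or_ne η ⊤ with rfl | htop
    · exact ⟨1, one_pos, le_top⟩
    · refine ⟨η.toReal / 2, half_pos (ENNReal.toReal_pos hη.ne' htop), ?_⟩
      rw [← ENNReal.ofReal_add (by positivity) (by positivity), add_halves,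
        ENNReal.ofReal_toReal htop]
  filter_upwards [ENNReal.tendsto_nhds_zero.1 (hb0 (δ * ε ^ 2) (by positivity))
    (ENNReal.ofReal δ) (by simpa using hδ)] with i hi
  refine (measure_le_of_integral_sq_kernel_le (hX i) (hY i) (hlaw i) (hψ i) (hint i) (hb i)
    hε (δ := δ)).trans (le_trans ?_ hδη)
  gcongr
  refine le_trans (measure_mono fun ω hω => ?_) hi
  exact (show δ * ε ^ 2 ≤ b i (X i ω) from hω).trans (le_abs_self _)

namespace SMC

/-! ### The one-step transition of the labelled population. -/

section kernel

variable {X : Type*} [MeasurableSpace X] {N : ℕ}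

/-- The mutation kernel acting on labelled particles; the label is kept. -/
noncomputable abbrev labelledKernel (N : ℕ) (M : Kernel X X) : Kernel (Fin N × X) (Fin N × X) :=
  Kernel.id ∥ₖ M

/-- The law of the lineage (block label and position) of one offspring of the population `s`,
after multinomial selection with potential `G` and mutation with kernel `M`. -/
noncomputable def offspringLaw (M : Kernel X X) (G : X → ℝ) (s : Fin N → Fin N × X) :
    Measure (Fin N × X) :=
  ∑ a, ENNReal.ofReal (G (s a).2 / ∑ l, G (s l).2) • labelledKernel N M (s a)

variable (M : Kernel X X) [IsMarkovKernel M] {G : X → ℝ}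

omit [MeasurableSpace X] in
theorem sum_potential_pos [NeZero N] (hpos : ∀ x, 0 < G x) (s : Fin N → Fin N × X) :
    0 < ∑ l, G (s l).2 :=
  Finset.sum_pos (fun _ _ => hpos _) Finset.univ_nonempty

theorem isProbabilityMeasure_offspringLaw [NeZero N] (hpos : ∀ x, 0 < G x)
    (s : Fin N → Fin N × X) : IsProbabilityMeasure (offspringLaw M G s) := by
  have hS := sum_potential_pos hpos s
  constructor
  simp only [offspringLaw, Measure.finsetSum_apply, Measure.smul_apply, measure_univ, smul_eq_mul,
    mul_one]
  rw [← ENNReal.ofReal_sum_of_nonneg fun a _ => div_nonneg (hpos _).le hS.le, ← Finset.sum_div,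
    div_self hS.ne', ENNReal.ofReal_one]

omit [IsMarkovKernel M] in
theorem offspringLaw_apply (s : Fin N → Fin N × X) (B : Set (Fin N × X)) :
    offspringLaw M G s B =
      ∑ a, ENNReal.ofReal (G (s a).2 / ∑ l, G (s l).2) * labelledKernel N M (s a) B := by
  simp [offspringLaw]

/-- The transition kernel of the population: the offspring are drawn independently. -/
noncomputable def populationKernel [NeZero N] (hG : Measurable G) (hpos : ∀ x, 0 < G x) :
    Kernel (Fin N → Fin N × X) (Fin N → Fin N × X) where
  toFun s := Measure.pi fun _ => offspringLaw M G s
  measurable' := by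
    have := isProbabilityMeasure_offspringLaw (N := N) M hpos
    -- Boxes generate the product σ-field, and the mass of a box is a finite product of finite sums
    -- measurable in `s`.
    refine Measurable.measure_of_isPiSystem_of_isProbabilityMeasure generateFrom_pi.symm
      isPiSystem_pi ?_
    rintro _ ⟨B, hB, rfl⟩
    simp only [Measure.pi_pi, offspringLaw_apply]
    refine Finset.measurable_prod _ fun i _ => Finset.measurable_sum _ fun a _ => ?_
    refine Measurable.mul (by fun_prop) ?_
    exact (Kernel.measurable_coe (labelledKernel N M) (hB i (Set.mem_univ i))).comp
      (measurable_pi_apply a)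

theorem populationKernel_apply [NeZero N] (hG : Measurable G) (hpos : ∀ x, 0 < G x)
    (s : Fin N → Fin N × X) :
    populationKernel M hG hpos s = Measure.pi fun _ => offspringLaw M G s := rfl

instance [NeZero N] (hG : Measurable G) (hpos : ∀ x, 0 < G x) :
    IsMarkovKernel (populationKernel (N := N) M hG hpos) where
  isProbabilityMeasure s := by
    have := isProbabilityMeasure_offspringLaw (N := N) M hpos s
    rw [populationKernel_apply]
    infer_instance

end kernel

/-! ### The labelled particle system follows the population kernel. -/

section lineage

variable {X Ω : Type*} [MeasurableSpace X] {N : ℕ}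

/-- The particles at time `m`, labelled with their ancestors at time `ℓ`. -/
def lineage (ξ : ℕ → Fin N → Ω → X) (I : ℕ → Fin N → Ω → Fin N) (ℓ m : ℕ) (ω : Ω) :
    Fin N → Fin N × X :=
  fun i => (enoch (fun k i => I k i ω) ℓ m i, ξ m i ω)

theorem measurable_enoch [MeasurableSpace Ω] {I : ℕ → Fin N → Ω → Fin N} (ℓ m : ℕ)
    (hI : ∀ k ∈ Finset.Icc 1 m, ∀ i, Measurable (I k i)) (i : Fin N) :
    Measurable fun ω => enoch (fun k i => I k i ω) ℓ m i := by
  induction m generalizing i with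
  | zero => exact measurable_const
  | succ m ih =>
    unfold enoch
    by_cases h : m + 1 ≤ ℓ
    · simp [h]
    · simp only [h, if_false]
      have h1 : Measurable fun ω => (fun j => enoch (fun k i => I k i ω) ℓ m j) :=
        measurable_pi_lambda _ fun j => ih (fun k hk => hI k (by simp at hk ⊢; lia)) j
      have h2 : Measurable fun p : (Fin N → Fin N) × Fin N => p.1 p.2 := measurable_of_finite _
      exact h2.comp (h1.prodMk (hI (m + 1) (by simp) i))

theorem measurable_lineage [MeasurableSpace Ω] {ξ : ℕ → Fin N → Ω → X}
    {I : ℕ → Fin N → Ω → Fin N} (ℓ m : ℕ)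
    (hI : ∀ k ∈ Finset.Icc 1 m, ∀ i, Measurable (I k i)) (hξ : ∀ i, Measurable (ξ m i)) :
    Measurable (lineage ξ I ℓ m) :=
  measurable_pi_lambda _ fun i => (measurable_enoch ℓ m hI i).prodMk (hξ i)

theorem measurable_particle_history (ξ : ℕ → Fin N → Ω → X) (I : ℕ → Fin N → Ω → Fin N) (m : ℕ)
    (i : Fin N) : Measurable[history ξ I m] (ξ m i) := by
  refine measurable_iff_comap_le.2 (le_sup_of_le_left ?_)
  refine le_iSup₂_of_le m (by simp) (le_iSup (fun i => MeasurableSpace.comap (ξ m i) _) i)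

theorem measurable_index_history (ξ : ℕ → Fin N → Ω → X) (I : ℕ → Fin N → Ω → Fin N) {k m : ℕ}
    (hk : k ∈ Finset.Icc 1 m) (i : Fin N) : Measurable[history ξ I m] (I k i) := by
  refine measurable_iff_comap_le.2 (le_sup_of_le_right ?_)
  refine le_iSup₂_of_le k hk (le_iSup (fun i => MeasurableSpace.comap (I k i) _) i)

theorem _root_.MeasureTheory.setLIntegral_eq_sum_fiber {J : Type*} [MeasurableSpace Ω]
    [Fintype J] [MeasurableSpace J] [MeasurableSingletonClass J] (μ : Measure Ω) {A : Set Ω}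
    (hA : MeasurableSet A) {c : Ω → J} (hc : Measurable c) (F : Ω → ENNReal) :
    ∫⁻ ω in A, F ω ∂μ = ∑ j, ∫⁻ ω in A ∩ c ⁻¹' {j}, F ω ∂μ := by
  have : A = ⋃ j, A ∩ c ⁻¹' {j} := by ext; simp
  conv_lhs => rw [this]
  rw [lintegral_iUnion (fun j => hA.inter (hc (measurableSet_singleton j))), tsum_fintype]
  intro j k hjk
  refine Disjoint.mono Set.inter_subset_right Set.inter_subset_right ?_
  exact Disjoint.preimage _ (by simpa using hjk)

theorem IsParticleSystem.measurable_lineage {Z : Type*} [MeasurableSpace Ω]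
    {P : Measure Ω} {M : Kernel X X} {χ : Measure X} {g : Z → X → ℝ} {z : ℕ → Z} {n : ℕ}
    {ξ : ℕ → Fin N → Ω → X} {I : ℕ → Fin N → Ω → Fin N}
    (hsys : IsParticleSystem P M χ g z n ξ I) (ℓ : ℕ) {m : ℕ} (hm : m ≤ n) :
    Measurable (lineage ξ I ℓ m) :=
  SMC.measurable_lineage ℓ m (fun j hj => hsys.measurable_index j (by simp at hj ⊢; lia))
    (hsys.measurable_particle m hm)

/-- The update rule fixes the parent indices and constrains positions, whereas a labelled box also
constrains the inherited label, a function of the random parent. Splitting over the values ε of the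
labels at time `m` and α of the parent indices turns that constraint into one on positions alone.
The event {labels = ε} belongs to the history, so it may join the conditioning event. -/
theorem IsParticleSystem.measure_lineage_inter {Z : Type*} [MeasurableSpace Ω] [NeZero N]
    {P : Measure Ω} [IsProbabilityMeasure P]
    {M : Kernel X X} [IsMarkovKernel M] {χ : Measure X} {g : Z → X → ℝ}
    (hg_meas : ∀ z, Measurable (g z)) (hg_pos : ∀ z x, 0 < g z x) {z : ℕ → Z} {n : ℕ}
    {ξ : ℕ → Fin N → Ω → X} {I : ℕ → Fin N → Ω → Fin N}
    (hsys : IsParticleSystem P M χ g z n ξ I) {ℓ m : ℕ} (hℓ : ℓ ≤ m) (hm : m < n)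
    {A : Set (Fin N → Fin N × X)} (hA : MeasurableSet A) {B : Fin N → Set (Fin N × X)}
    (hB : ∀ i, MeasurableSet (B i)) :
    P (lineage ξ I ℓ (m + 1) ⁻¹' Set.univ.pi B ∩ lineage ξ I ℓ m ⁻¹' A) =
      ∫⁻ ω in lineage ξ I ℓ m ⁻¹' A,
        populationKernel M (hg_meas (z m)) (hg_pos (z m)) (lineage ξ I ℓ m ω) (Set.univ.pi B)
          ∂P := by
  have hLm := hsys.measurable_lineage ℓ hm.le
  have hLm' := hsys.measurable_lineage ℓ (m := m + 1) hm
  have hprob := isProbabilityMeasure_offspringLaw (N := N) M (hg_pos (z m))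
  have hLh : Measurable[history ξ I m] (lineage ξ I ℓ m) :=
    @SMC.measurable_lineage X Ω _ N (history ξ I m) ξ I ℓ m
      (fun k hk => measurable_index_history ξ I hk) (measurable_particle_history ξ I m)
  let e : Ω → Fin N → Fin N := fun ω i => (lineage ξ I ℓ m ω i).1
  let a : Ω → Fin N → Fin N := fun ω i => I (m + 1) i ω
  have hlab : Measurable fun (s : Fin N → Fin N × X) i => (s i).1 := by fun_prop
  have he : Measurable e := hlab.comp hLm
  have heh : Measurable[history ξ I m] e := hlab.comp hLh
  have ha : Measurable a :=
    measurable_pi_lambda _ fun i => hsys.measurable_index (m + 1) (by simp; lia) i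
  have hbox : MeasurableSet (Set.univ.pi B) := MeasurableSet.univ_pi hB
  have hstep (ω : Ω) (i : Fin N) : lineage ξ I ℓ (m + 1) ω i =
      (e ω (a ω i), ξ (m + 1) i ω) := by
    simp only [lineage, e, a]
    rw [enoch, if_neg (by lia)]
  have hsec (j : Fin N) (i : Fin N) : MeasurableSet (Prod.mk j ⁻¹' B i) :=
    measurable_prodMk_left (hB i)
  rw [Set.inter_comm, ← setLIntegral_one, setLIntegral_eq_sum_fiber P
    ((hLm hA).inter (hLm' hbox)) (ha.prodMk he), Fintype.sum_prod_type_right,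
    setLIntegral_eq_sum_fiber P (hLm hA) he]
  refine Finset.sum_congr rfl fun ε _ => ?_
  have hpast : MeasurableSet[history ξ I m] (lineage ξ I ℓ m ⁻¹' A ∩ e ⁻¹' {ε}) :=
    (hLh hA).inter (heh (measurableSet_singleton ε))
  have hpast' : MeasurableSet (lineage ξ I ℓ m ⁻¹' A ∩ e ⁻¹' {ε}) :=
    (hLm hA).inter (he (measurableSet_singleton ε))
  have hlhs (α : Fin N → Fin N) :
      lineage ξ I ℓ m ⁻¹' A ∩ lineage ξ I ℓ (m + 1) ⁻¹' Set.univ.pi B ∩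
        (fun ω => (a ω, e ω)) ⁻¹' {(α, ε)} = lineage ξ I ℓ m ⁻¹' A ∩ e ⁻¹' {ε} ∩
          ⋂ i, {ω | I (m + 1) i ω = α i ∧ ξ (m + 1) i ω ∈ Prod.mk (ε (α i)) ⁻¹' B i} := by
    ext ω
    simp only [Set.mem_inter_iff, Set.mem_preimage, Set.mem_univ_pi, Set.mem_singleton_iff,
      Set.mem_iInter, Set.mem_ofPred_eq, Prod.mk.injEq, hstep]
    constructor
    · rintro ⟨⟨h1, h2⟩, rfl, rfl⟩
      exact ⟨⟨h1, rfl⟩, fun i => ⟨rfl, h2 i⟩⟩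
    · rintro ⟨⟨h1, rfl⟩, h3⟩
      have h4 : a ω = α := funext fun i => (h3 i).1
      subst h4
      exact ⟨⟨h1, fun i => (h3 i).2⟩, rfl, rfl⟩
  simp_rw [hlhs, setLIntegral_one]
  simp_rw [hsys.update m hm _ hpast _ _ fun i => hsec _ i]
  have hpart (i : Fin N) : Measurable (ξ m i) := hsys.measurable_particle m hm.le i
  rw [← lintegral_finsetSum]
  · refine setLIntegral_congr_fun hpast' fun ω hω => ?_
    have hω : e ω = ε := hω.2
    subst hω
    simp only [populationKernel_apply, Measure.pi_pi, offspringLaw_apply]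
    -- Distributing the product of mixtures yields the sum over parent assignments α.
    rw [Finset.prod_univ_sum, Fintype.piFinset_univ]
    refine Finset.sum_congr rfl fun α _ => Finset.prod_congr rfl fun i _ => ?_
    congr 1
    rw [Kernel.parallelComp_apply, Kernel.id_apply, Measure.dirac_prod,
      Measure.map_apply measurable_prodMk_left (hB i)]
    rfl
  · intro α _
    refine Finset.measurable_prod _ fun i _ => Measurable.mul ?_ ?_
    · have := hg_meas (z m)
      fun_prop
    · exact (Kernel.measurable_coe M (hsec _ i)).comp (hpart _)

theorem IsParticleSystem.map_lineage {Z : Type*} [MeasurableSpace Ω] [NeZero N]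
    {P : Measure Ω} [IsProbabilityMeasure P]
    {M : Kernel X X} [IsMarkovKernel M] {χ : Measure X} {g : Z → X → ℝ}
    (hg_meas : ∀ z, Measurable (g z)) (hg_pos : ∀ z x, 0 < g z x) {z : ℕ → Z} {n : ℕ}
    {ξ : ℕ → Fin N → Ω → X} {I : ℕ → Fin N → Ω → Fin N}
    (hsys : IsParticleSystem P M χ g z n ξ I) {ℓ m : ℕ} (hℓ : ℓ ≤ m) (hm : m < n) :
    P.map (fun ω => (lineage ξ I ℓ m ω, lineage ξ I ℓ (m + 1) ω)) =
      P.map (lineage ξ I ℓ m) ⊗ₘ populationKernel M (hg_meas (z m)) (hg_pos (z m)) := by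
  have hLm := hsys.measurable_lineage ℓ hm.le
  have hLm' := hsys.measurable_lineage ℓ (m := m + 1) hm
  refine Measure.ext_prod_iff.2 fun {A B} hA hB => ?_
  -- With the past event `A` fixed, both sides are finite measures of the future, so agreement on
  -- boxes and equal total mass suffice.
  have hfix : (P.restrict (lineage ξ I ℓ m ⁻¹' A)).map (lineage ξ I ℓ (m + 1)) =
      ((P.restrict (lineage ξ I ℓ m ⁻¹' A)).map (lineage ξ I ℓ m)).bind
        (populationKernel M (hg_meas (z m)) (hg_pos (z m))) := by
    refine ext_of_generate_finite _ generateFrom_pi.symm isPiSystem_pi ?_ ?_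
    · rintro _ ⟨B, hB, rfl⟩
      replace hB : ∀ i, MeasurableSet (B i) := fun i => hB i (Set.mem_univ i)
      have hbox : MeasurableSet (Set.univ.pi B) := MeasurableSet.univ_pi hB
      rw [Measure.map_apply hLm' hbox, Measure.restrict_apply (hLm' hbox),
        Measure.bind_apply hbox (Kernel.measurable _).aemeasurable,
        lintegral_map (Kernel.measurable_coe _ hbox) hLm]
      exact hsys.measure_lineage_inter hg_meas hg_pos hℓ hm hA hB
    · rw [Measure.map_apply hLm' MeasurableSet.univ, Measure.bind_apply MeasurableSet.univ
        (Kernel.measurable _).aemeasurable, lintegral_map (Kernel.measurable_coe _ .univ) hLm]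
      simp
  have h1 := congrArg (fun ν => ν B) hfix
  rw [Measure.map_apply hLm' hB, Measure.restrict_apply (hLm' hB),
    Measure.bind_apply hB (Kernel.measurable _).aemeasurable,
    ← Measure.restrict_map hLm hA] at h1
  rw [Measure.map_apply (hLm.prodMk hLm') (hA.prod hB), Measure.compProd_apply_prod hA hB, ← h1,
    Set.inter_comm]
  rfl

end lineage
-- One-step recursions for the Feynman-Kac flow and the limiting variance.
section feynmanKac

variable {X : Type*} [MeasurableSpace X] (M : Kernel X X) [IsMarkovKernel M]

/-- The action `x ↦ G x * ∫ f dM(x, ·)` of the one-step unnormalised kernel on functions. -/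
noncomputable def backward (G f : X → ℝ) (x : X) : ℝ := G x * ∫ y, f y ∂(M x)

omit [IsMarkovKernel M] in
theorem measurable_backward {G f : X → ℝ} (hG : Measurable G) (hf : Measurable f) :
    Measurable (backward M G f) :=
  hG.mul (hf.stronglyMeasurable.integral_kernel (κ := M)).measurable

theorem exists_abs_backward_le {G f : X → ℝ} (hpos : ∀ x, 0 < G x) (hG : ∃ C, ∀ x, G x ≤ C)
    (hf : ∃ C, ∀ x, |f x| ≤ C) : ∃ C, ∀ x, |backward M G f x| ≤ C := by
  obtain ⟨A, hA⟩ := hG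
  obtain ⟨C, hC⟩ := hf
  refine ⟨A * C, fun x => ?_⟩
  have h1 : |∫ y, f y ∂(M x)| ≤ C := by
    simpa using norm_integral_le_of_norm_le_const (f := f) (μ := M x) (ae_of_all _ hC)
  rw [backward, abs_mul, abs_of_pos (hpos x)]
  exact mul_le_mul (hA x) h1 (abs_nonneg _) ((hpos x).le.trans (hA x))

theorem backward_one (G : X → ℝ) : backward M G (fun _ => 1) = G := by
  ext x; simp [backward]

theorem stepKernel_apply {G : X → ℝ} (hG : Measurable G) (x : X) :
    stepKernel M G x = ENNReal.ofReal (G x) • M x := by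
  rw [stepKernel, Kernel.withDensity_apply _ (by fun_prop)]
  exact withDensity_const _

theorem isFiniteKernel_stepKernel {G : X → ℝ} (hG : Measurable G) (hb : ∃ C, ∀ x, G x ≤ C) :
    IsFiniteKernel (stepKernel M G) := by
  obtain ⟨C, hC⟩ := hb
  refine ⟨⟨ENNReal.ofReal C, ENNReal.ofReal_lt_top, fun x => ?_⟩⟩
  rw [stepKernel_apply M hG]
  simpa using ENNReal.ofReal_le_ofReal (hC x)

theorem integral_stepKernel {G : X → ℝ} (hG : Measurable G) (hpos : ∀ x, 0 < G x) (f : X → ℝ)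
    (x : X) : ∫ y, f y ∂(stepKernel M G x) = backward M G f x := by
  rw [stepKernel_apply M hG, integral_smul_measure, ENNReal.toReal_ofReal (hpos x).le]
  rfl

variable {Z : Type*} {g : Z → X → ℝ} (hg_meas : ∀ z, Measurable (g z))
  (hg_pos : ∀ z x, 0 < g z x) (hg_bdd : ∀ z, ∃ C : ℝ, ∀ x, g z x ≤ C) (z : ℕ → Z)

include hg_meas hg_bdd

theorem isFiniteKernel_iterKernel (k j : ℕ) : IsFiniteKernel (iterKernel M g z k j) := by
  induction j with
  | zero => unfold iterKernel; infer_instance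
  | succ j ih =>
    have := isFiniteKernel_stepKernel M (hg_meas (z (k + j))) (hg_bdd _)
    unfold iterKernel
    infer_instance

theorem isFiniteKernel_unnormKernel (k m : ℕ) : IsFiniteKernel (unnormKernel M g z k m) :=
  isFiniteKernel_iterKernel M hg_meas hg_bdd z k (m - k)

include hg_pos in
theorem integral_unnormKernel_succ {k m : ℕ} (hkm : k ≤ m) {f : X → ℝ} (hf : Measurable f)
    (hfb : ∃ C, ∀ x, |f x| ≤ C) (x : X) :
    ∫ y, f y ∂(unnormKernel M g z k (m + 1) x) =
      ∫ y, backward M (g (z m)) f y ∂(unnormKernel M g z k m x) := by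
  have h1 := isFiniteKernel_iterKernel M hg_meas hg_bdd z k (m - k)
  have h2 := isFiniteKernel_stepKernel M (hg_meas (z m)) (hg_bdd _)
  obtain ⟨C, hC⟩ := hfb
  have heq : unnormKernel M g z k (m + 1) = stepKernel M (g (z m)) ∘ₖ unnormKernel M g z k m := by
    rw [unnormKernel, Nat.succ_sub hkm, iterKernel, Nat.add_sub_cancel' hkm, unnormKernel]
  have h3 := isFiniteKernel_unnormKernel M hg_meas hg_bdd z k m
  rw [heq, Kernel.integral_comp]
  · simp_rw [integral_stepKernel M (hg_meas _) (hg_pos _)]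
  · exact Integrable.of_bound hf.aestronglyMeasurable C (ae_of_all _ hC)

omit hg_meas hg_bdd in
theorem iterKernel_add (m j : ℕ) : iterKernel M g z 0 (m + j) =
    iterKernel M g z m j ∘ₖ iterKernel M g z 0 m := by
  induction j with
  | zero => simp [iterKernel]
  | succ j ih => rw [← add_assoc, iterKernel, ih, iterKernel, Kernel.comp_assoc, zero_add]

variable (χ : Measure X) [IsProbabilityMeasure χ]

/-- The unnormalised Feynman-Kac measure at time `m`. -/
noncomputable def unnormPredictor (g : Z → X → ℝ) (m : ℕ) : Measure X :=
  χ.bind (unnormKernel M g z 0 m)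

omit hg_meas hg_bdd [IsProbabilityMeasure χ] in
theorem unnormPredictor_zero : unnormPredictor M z χ g 0 = χ := by
  simp [unnormPredictor, unnormKernel, iterKernel]

omit hg_meas hg_bdd [IsProbabilityMeasure χ] in
theorem unnormPredictor_bind {m n : ℕ} (hmn : m ≤ n) :
    (unnormPredictor M z χ g m).bind (unnormKernel M g z m n) = unnormPredictor M z χ g n := by
  obtain ⟨j, rfl⟩ := Nat.exists_eq_add_of_le hmn
  simp only [unnormPredictor, unnormKernel, Nat.add_sub_cancel_left, Nat.sub_zero, iterKernel_add]
  exact Measure.comp_assoc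

theorem isFiniteMeasure_unnormPredictor (m : ℕ) :
    IsFiniteMeasure (unnormPredictor M z χ g m) := by
  have := isFiniteKernel_unnormKernel M hg_meas hg_bdd z 0 m
  unfold unnormPredictor
  infer_instance

include hg_pos in
theorem integral_unnormPredictor_succ (m : ℕ) {f : X → ℝ} (hf : Measurable f)
    (hfb : ∃ C, ∀ x, |f x| ≤ C) :
    ∫ x, f x ∂(unnormPredictor M z χ g (m + 1)) =
      ∫ x, backward M (g (z m)) f x ∂(unnormPredictor M z χ g m) := by
  have h1 := isFiniteMeasure_unnormPredictor M hg_meas hg_bdd z χ m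
  have h2 := isFiniteMeasure_unnormPredictor M hg_meas hg_bdd z χ (m + 1)
  have h3 := isFiniteKernel_unnormKernel M hg_meas hg_bdd z m (m + 1)
  obtain ⟨C, hC⟩ := hfb
  have hi : Integrable f (unnormPredictor M z χ g (m + 1)) :=
    Integrable.of_bound hf.aestronglyMeasurable C (ae_of_all _ hC)
  rw [← unnormPredictor_bind M z χ m.le_succ] at hi ⊢
  rw [Measure.comp_eq_comp_const_apply] at hi ⊢
  rw [Kernel.integral_comp hi, Kernel.const_apply]
  simp_rw [integral_unnormKernel_succ M hg_meas hg_pos hg_bdd z le_rfl hf ⟨C, hC⟩]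
  simp [unnormKernel, iterKernel, Kernel.id_apply,
    (measurable_backward M (hg_meas _) hf).stronglyMeasurable]

-- The next mass is the integral of a strictly positive potential against a nonzero measure; this
-- legitimises every normalisation.
include hg_pos in
theorem unnormPredictor_real_univ_pos (m : ℕ) : 0 < (unnormPredictor M z χ g m).real Set.univ := by
  induction m with
  | zero => rw [unnormPredictor_zero]; simp
  | succ m ih =>
    have h1 := isFiniteMeasure_unnormPredictor M hg_meas hg_bdd z χ m
    have h2 := integral_unnormPredictor_succ M hg_meas hg_pos hg_bdd z χ m
      (measurable_const (a := (1 : ℝ))) ⟨1, fun _ => by simp⟩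
    rw [backward_one] at h2
    simp only [integral_const, smul_eq_mul, mul_one] at h2
    rw [h2, integral_pos_iff_support_of_nonneg (fun x => (hg_pos _ x).le)]
    · have : Function.support (g (z m)) = Set.univ :=
        Set.eq_univ_of_forall fun x => (hg_pos _ x).ne'
      rw [this]
      exact (ENNReal.toReal_pos_iff.1 ih).1
    · obtain ⟨C, hC⟩ := hg_bdd (z m)
      exact Integrable.of_bound (hg_meas _).aestronglyMeasurable C
        (ae_of_all _ fun x => by simpa [abs_of_pos (hg_pos (z m) x)] using hC x)

omit hg_meas hg_bdd [IsProbabilityMeasure χ] in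
theorem predictor_eq (m : ℕ) : predictor M χ g z m =
    (unnormPredictor M z χ g m Set.univ)⁻¹ • unnormPredictor M z χ g m := rfl

omit hg_meas hg_bdd [IsProbabilityMeasure χ] in
theorem integral_predictor (m : ℕ) (f : X → ℝ) : ∫ x, f x ∂(predictor M χ g z m) =
    (∫ x, f x ∂(unnormPredictor M z χ g m)) / (unnormPredictor M z χ g m).real Set.univ := by
  rw [predictor_eq, integral_smul_measure, ENNReal.toReal_inv, smul_eq_mul, div_eq_inv_mul]
  rfl

omit hg_meas hg_bdd in
theorem predictor_zero : predictor M χ g z 0 = χ := by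
  simp [predictor_eq, unnormPredictor_zero]

include hg_pos in
theorem unnormPredictor_real_univ_succ (m : ℕ) :
    (unnormPredictor M z χ g (m + 1)).real Set.univ =
      (unnormPredictor M z χ g m).real Set.univ * ∫ x, g (z m) x ∂(predictor M χ g z m) := by
  have h2 := integral_unnormPredictor_succ M hg_meas hg_pos hg_bdd z χ m
      (measurable_const (a := (1 : ℝ))) ⟨1, fun _ => by simp⟩
  rw [backward_one] at h2
  simp only [integral_const, smul_eq_mul, mul_one] at h2
  have h3 := unnormPredictor_real_univ_pos M hg_meas hg_pos hg_bdd z χ m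
  rw [integral_predictor, h2]
  field_simp

include hg_pos in
theorem integral_potential_predictor_pos (m : ℕ) :
    0 < ∫ x, g (z m) x ∂(predictor M χ g z m) := by
  have h1 := unnormPredictor_real_univ_succ M hg_meas hg_pos hg_bdd z χ m
  have h2 := unnormPredictor_real_univ_pos M hg_meas hg_pos hg_bdd z χ m
  have h3 := unnormPredictor_real_univ_pos M hg_meas hg_pos hg_bdd z χ (m + 1)
  rw [h1] at h3
  exact (pos_iff_pos_of_mul_pos h3).1 h2

include hg_pos in
theorem integral_predictor_succ (m : ℕ) {f : X → ℝ} (hf : Measurable f)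
    (hfb : ∃ C, ∀ x, |f x| ≤ C) :
    ∫ x, f x ∂(predictor M χ g z (m + 1)) =
      (∫ x, backward M (g (z m)) f x ∂(predictor M χ g z m)) /
        ∫ x, g (z m) x ∂(predictor M χ g z m) := by
  rw [integral_predictor, integral_unnormPredictor_succ M hg_meas hg_pos hg_bdd z χ m hf hfb,
    unnormPredictor_real_univ_succ M hg_meas hg_pos hg_bdd z χ m,
    integral_predictor M z χ m (backward M (g (z m)) f), div_div]

-- The semigroup property makes each denominator of the variance a ratio of normalising constants,
-- so one more step multiplies all of them by the same factor.
omit hg_meas hg_bdd [IsProbabilityMeasure χ] in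
theorem predictor_bind_real_univ {m n : ℕ} (hmn : m ≤ n) :
    ((predictor M χ g z m).bind (unnormKernel M g z m n)).real Set.univ =
      (unnormPredictor M z χ g n).real Set.univ / (unnormPredictor M z χ g m).real Set.univ := by
  rw [predictor_eq, Measure.comp_smul, unnormPredictor_bind M z χ hmn,
    measureReal_ennreal_smul_apply, ENNReal.toReal_inv, div_eq_inv_mul]
  rfl

/-- The uncentred version of the truncated asymptotic variance. -/
noncomputable def limitVariance (g : Z → X → ℝ) (n ℓ : ℕ) (f : X → ℝ) : ℝ :=
  ∑ m ∈ Finset.Icc ℓ n,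
    (∫ x, (∫ y, f y ∂(unnormKernel M g z m n x)) ^ 2 ∂(predictor M χ g z m)) /
      (((predictor M χ g z m).bind (unnormKernel M g z m n)).real Set.univ) ^ 2

omit hg_meas hg_bdd [IsProbabilityMeasure χ] in
theorem integral_unnormKernel_self (n : ℕ) {f : X → ℝ} (hf : Measurable f) (x : X) :
    ∫ y, f y ∂(unnormKernel M g z n n x) = f x := by
  simp [unnormKernel, iterKernel, Kernel.id_apply, hf.stronglyMeasurable]

include hg_pos in
theorem predictor_bind_self_real_univ (n : ℕ) :
    ((predictor M χ g z n).bind (unnormKernel M g z n n)).real Set.univ = 1 := by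
  rw [predictor_bind_real_univ M z χ le_rfl, div_self]
  exact (unnormPredictor_real_univ_pos M hg_meas hg_pos hg_bdd z χ n).ne'

include hg_pos in
theorem limitVariance_self (ℓ : ℕ) {f : X → ℝ} (hf : Measurable f) :
    limitVariance M z χ g ℓ ℓ f = ∫ x, f x ^ 2 ∂(predictor M χ g z ℓ) := by
  simp [limitVariance, predictor_bind_self_real_univ M hg_meas hg_pos hg_bdd z χ,
    integral_unnormKernel_self M z ℓ hf]

-- The last time contributes ∫ f². In every earlier term the final step of the semigroup is absorbed
-- into the test function, and the denominator gains the squared mean potential.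
include hg_pos in
theorem limitVariance_succ {n ℓ : ℕ} (h : ℓ ≤ n) {f : X → ℝ} (hf : Measurable f)
    (hfb : ∃ C, ∀ x, |f x| ≤ C) :
    limitVariance M z χ g (n + 1) ℓ f = ∫ x, f x ^ 2 ∂(predictor M χ g z (n + 1)) +
      limitVariance M z χ g n ℓ (backward M (g (z n)) f) /
        (∫ x, g (z n) x ∂(predictor M χ g z n)) ^ 2 := by
  rw [limitVariance, Finset.sum_Icc_succ_top (by lia), add_comm]
  congr 1
  · simp [predictor_bind_self_real_univ M hg_meas hg_pos hg_bdd z χ,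
      integral_unnormKernel_self M z (n + 1) hf]
  · rw [limitVariance, Finset.sum_div]
    refine Finset.sum_congr rfl fun m hm => ?_
    have hmn : m ≤ n := (Finset.mem_Icc.1 hm).2
    simp_rw [integral_unnormKernel_succ M hg_meas hg_pos hg_bdd z hmn hf hfb]
    rw [predictor_bind_real_univ M z χ hmn, predictor_bind_real_univ M z χ (by lia : m ≤ n + 1),
      unnormPredictor_real_univ_succ M hg_meas hg_pos hg_bdd z χ n, div_div, ← mul_pow]
    congr 2
    ring

end feynmanKac
-- Conditional moments of the offspring in terms of the current population.
section offspring

variable {X : Type*} [MeasurableSpace X] {N : ℕ} (M : Kernel X X) [IsMarkovKernel M] {G : X → ℝ}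

theorem integral_offspringLaw [NeZero N] (hpos : ∀ x, 0 < G x) (s : Fin N → Fin N × X)
    {φ : Fin N × X → ℝ} (hφ : Measurable φ) {C : ℝ} (hC : ∀ p, |φ p| ≤ C) :
    ∫ p, φ p ∂(offspringLaw M G s) =
      ∑ a, G (s a).2 / (∑ l, G (s l).2) * ∫ y, φ ((s a).1, y) ∂(M (s a).2) := by
  have hS := sum_potential_pos hpos s
  have hi (a : Fin N) : Integrable φ (labelledKernel N M (s a)) :=
    Integrable.of_bound hφ.aestronglyMeasurable C (ae_of_all _ hC)
  rw [offspringLaw, integral_finsetSum_measure fun a _ =>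
    (hi a).smul_measure ENNReal.ofReal_ne_top]
  refine Finset.sum_congr rfl fun a _ => ?_
  rw [integral_smul_measure, ENNReal.toReal_ofReal (div_nonneg (hpos _).le hS.le), smul_eq_mul,
    Kernel.parallelComp_apply, Kernel.id_apply, Measure.dirac_prod,
    integral_map measurable_prodMk_left.aemeasurable hφ.aestronglyMeasurable]

/-- The variance estimate built from the block labels, for a function that need not be centred. -/
noncomputable def blockVariance (s : Fin N → Fin N × X) (f : X → ℝ) : ℝ :=
  (1 / (N : ℝ)) * ∑ i, (∑ j with (s j).1 = i, f (s j).2) ^ 2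

theorem integral_snd_offspringLaw [NeZero N] (hpos : ∀ x, 0 < G x) (s : Fin N → Fin N × X)
    {f : X → ℝ} (hf : Measurable f) {C : ℝ} (hC : ∀ x, |f x| ≤ C) :
    ∫ p, f p.2 ∂(offspringLaw M G s) =
      particleMean (fun i => (s i).2) (backward M G f) / particleMean (fun i => (s i).2) G := by
  have hN : (N : ℝ) ≠ 0 := NeZero.ne _
  rw [integral_offspringLaw M hpos s (φ := fun p => f p.2) (by fun_prop) fun p => hC p.2]
  simp only [particleMean, backward]
  rw [mul_div_mul_left _ _ (one_div_ne_zero hN), Finset.sum_div]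
  exact Finset.sum_congr rfl fun a _ => by ring

theorem setIntegral_fst_offspringLaw [NeZero N] (hpos : ∀ x, 0 < G x) (s : Fin N → Fin N × X)
    {f : X → ℝ} (hf : Measurable f) {C : ℝ} (hC : ∀ x, |f x| ≤ C) (e : Fin N) :
    ∫ p in Prod.fst ⁻¹' {e}, f p.2 ∂(offspringLaw M G s) =
      (∑ j with (s j).1 = e, backward M G f (s j).2) / ∑ l, G (s l).2 := by
  have hset : MeasurableSet (Prod.fst ⁻¹' {e} : Set (Fin N × X)) :=
    measurable_fst (measurableSet_singleton e)
  rw [← integral_indicator hset, integral_offspringLaw M hpos s (C := C)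
    (Measurable.indicator (by fun_prop) hset), Finset.sum_filter, Finset.sum_div]
  · refine Finset.sum_congr rfl fun a _ => ?_
    by_cases h : (s a).1 = e
    · have hind (y : X) : (Prod.fst ⁻¹' {e}).indicator (fun p : Fin N × X => f p.2)
          ((s a).1, y) = f y := Set.indicator_of_mem (by simp [h]) _
      simp only [hind]
      simp only [h, if_true, backward]
      ring
    · simp [h]
  · intro p
    by_cases h : p ∈ (Prod.fst ⁻¹' {e} : Set (Fin N × X))
    · simpa [Set.indicator_of_mem h] using hC p.2
    · simpa [Set.indicator_of_notMem h] using (abs_nonneg _).trans (hC p.2)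

/-- Offspring inherit the label of their parent, so the mass in block `e` is a sum of `backward M G
f` over parents in block `e`, divided by the total weight. Squaring and summing reproduces the block
variance one step earlier, which closes the recursion. -/
theorem sum_sq_setIntegral_offspringLaw [NeZero N] (hpos : ∀ x, 0 < G x)
    (s : Fin N → Fin N × X) {f : X → ℝ} (hf : Measurable f) {C : ℝ} (hC : ∀ x, |f x| ≤ C) :
    ∑ e, (∫ p in Prod.fst ⁻¹' {e}, f p.2 ∂(offspringLaw M G s)) ^ 2 =
      blockVariance s (backward M G f) / particleMean (fun i => (s i).2) G ^ 2 / N := by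
  have hN : (N : ℝ) ≠ 0 := NeZero.ne _
  have hS := (sum_potential_pos hpos s).ne'
  simp_rw [setIntegral_fst_offspringLaw M hpos s hf hC, div_pow]
  rw [← Finset.sum_div, blockVariance, particleMean]
  field_simp

theorem sum_sq_measureReal_offspringLaw [NeZero N] (hpos : ∀ x, 0 < G x)
    (s : Fin N → Fin N × X) :
    ∑ e, (offspringLaw M G s).real (Prod.fst ⁻¹' {e}) ^ 2 =
      blockVariance s G / particleMean (fun i => (s i).2) G ^ 2 / N := by
  have := sum_sq_setIntegral_offspringLaw M hpos s (f := fun _ => 1) measurable_const (C := 1)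
    fun _ => by simp
  rw [backward_one] at this
  simpa using this

omit [MeasurableSpace X] in
theorem blockVariance_eq (s : Fin N → Fin N × X) (f : X → ℝ) :
    blockVariance s f = particleMean (fun i => (s i).2) (fun x => f x ^ 2) +
      (1 / (N : ℝ)) * ∑ p ∈ Finset.univ.offDiag,
        blockProd Prod.fst (fun q : Fin N × X => f q.2) (s p.1) (s p.2) := by
  rw [blockVariance, particleMean, ← mul_add]
  congr 1
  have h1 : ∀ i : Fin N, (∑ j with (s j).1 = i, f (s j).2) ^ 2 =
      ∑ j, ∑ k, if (s j).1 = i ∧ (s k).1 = i then f (s j).2 * f (s k).2 else 0 := by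
    intro i
    rw [sq, Finset.sum_filter, Finset.sum_mul_sum]
    refine Finset.sum_congr rfl fun j _ => Finset.sum_congr rfl fun k _ => ?_
    by_cases hj : (s j).1 = i <;> by_cases hk : (s k).1 = i <;> simp [hj, hk]
  have h2 : ∑ i : Fin N, (∑ j with (s j).1 = i, f (s j).2) ^ 2 =
      ∑ p : Fin N × Fin N,
        blockProd Prod.fst (fun q : Fin N × X => f q.2) (s p.1) (s p.2) := by
    simp_rw [h1]
    rw [Finset.sum_comm, Fintype.sum_prod_type]
    refine Finset.sum_congr rfl fun j _ => ?_
    rw [Finset.sum_comm]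
    refine Finset.sum_congr rfl fun k _ => ?_
    simp only [blockProd, ite_and, Finset.sum_ite_eq, Finset.mem_univ, if_true]
    exact if_congr eq_comm rfl rfl
  rw [h2, ← Finset.univ_product_univ, ← Finset.diag_union_offDiag,
    Finset.sum_union (Finset.disjoint_diag_offDiag _), Finset.sum_diag]
  simp [blockProd, sq]

-- Expansion of a quadratic form, with twice the cross term against the constant 1 written by
-- polarisation so that only values of `blockVariance` occur.
omit [MeasurableSpace X] in
theorem blockVariance_sub (s : Fin N → Fin N × X) (f : X → ℝ) (d : ℝ) :
    blockVariance s (fun x => f x - d) = blockVariance s f -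
      d * (blockVariance s (fun x => f x + 1) - blockVariance s f - blockVariance s fun _ => 1) +
      d ^ 2 * blockVariance s fun _ => 1 := by
  simp only [blockVariance, ← mul_sub, mul_left_comm _ (1 / (N : ℝ)), ← mul_add]
  congr 1
  rw [← Finset.sum_sub_distrib, ← Finset.sum_sub_distrib, Finset.mul_sum, ← Finset.sum_sub_distrib,
    Finset.mul_sum, ← Finset.sum_add_distrib]
  refine Finset.sum_congr rfl fun i _ => ?_
  simp only [Finset.sum_sub_distrib, Finset.sum_add_distrib, Finset.sum_const, nsmul_eq_mul]
  ring

end offspring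

theorem integrable_sq_const_mul_sum_sub {S J : Type*} [MeasurableSpace S] {μ : Measure S}
    [IsFiniteMeasure μ] (T : Finset J) {F : J → S → ℝ} (hF : ∀ j, Measurable (F j)) {C : ℝ}
    (hC : ∀ j x, |F j x| ≤ C) (c d : ℝ) :
    Integrable (fun x => (c * ∑ j ∈ T, F j x - d) ^ 2) μ := by
  have h : MemLp (fun x => ∑ j ∈ T, F j x) 2 μ := memLp_finsetSum _ fun j _ =>
    MemLp.of_bound (hF j).aestronglyMeasurable C (ae_of_all _ (hC j))
  exact ((h.const_mul c).sub (memLp_const d)).integrable_sq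

/-! ### Convergence in probability of empirical means and block variances. -/

section convergence

variable {X Z Ω : Type*} [MeasurableSpace X] [MeasurableSpace Ω]
  {P : Measure Ω} [IsProbabilityMeasure P]
  {M : Kernel X X} [IsMarkovKernel M] {χ : Measure X} [IsProbabilityMeasure χ]
  {g : Z → X → ℝ} {n : ℕ} {z : ℕ → Z}
  {ξ : (N : ℕ) → ℕ → Fin (N + 1) → Ω → X} {I : (N : ℕ) → ℕ → Fin (N + 1) → Ω → Fin (N + 1)}

theorem measurable_particleMean {N : ℕ} {f : X → ℝ} (hf : Measurable f) :
    Measurable fun s : Fin N → Fin N × X => particleMean (fun i => (s i).2) f := by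
  unfold particleMean
  fun_prop

theorem measurable_blockVariance {N : ℕ} {f : X → ℝ} (hf : Measurable f) :
    Measurable fun s : Fin N → Fin N × X => blockVariance s f := by
  simp_rw [blockVariance_eq]
  refine (measurable_particleMean (hf.pow_const 2)).add (measurable_const.mul ?_)
  refine Finset.measurable_sum _ fun p _ => ?_
  exact (measurable_blockProd measurable_fst (hf.comp measurable_snd)).comp
    (f := fun s : Fin N → Fin N × X => (s p.1, s p.2)) (by fun_prop)

omit [IsMarkovKernel M] in
theorem tendstoInMeasure_particleMean_zero
    (hsys : ∀ N, IsParticleSystem P M χ g z n (ξ N) (I N)) {f : X → ℝ} (hf : Measurable f)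
    (hfb : ∃ C, ∀ x, |f x| ≤ C) :
    TendstoInMeasure P (fun N ω => particleMean (fun i => ξ N 0 i ω) f) atTop
      fun _ => ∫ x, f x ∂χ := by
  obtain ⟨C, hC⟩ := hfb
  have hY (N : ℕ) : Measurable fun ω i => ξ N 0 i ω :=
    measurable_pi_lambda _ fun i => (hsys N).measurable_particle 0 (Nat.zero_le _) i
  -- The initial sample has no past; conditioning on a `Unit`-valued variable fits it into the
  -- conditional Chebyshev scheme.
  have hlaw (N : ℕ) : P.map (fun ω => ((), fun i => ξ N 0 i ω)) =
      P.map (fun _ => ()) ⊗ₘ Kernel.const Unit (Measure.pi fun _ : Fin (N + 1) => χ) := by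
    rw [Measure.compProd_const, ← (hsys N).init, Measure.map_const, measure_univ, one_smul,
      Measure.dirac_prod, Measure.map_map measurable_prodMk_left (hY N)]
    rfl
  have hm (N : ℕ) : Measurable fun p : Unit × (Fin (N + 1) → X) =>
      particleMean p.2 f - ∫ x, f x ∂χ := by
    unfold particleMean; fun_prop
  have hint (N : ℕ) : Integrable (fun y : Fin (N + 1) → X =>
      (particleMean y f - ∫ x, f x ∂χ) ^ 2) (Measure.pi fun _ => χ) :=
    integrable_sq_const_mul_sum_sub Finset.univ (F := fun i (y : Fin (N + 1) → X) => f (y i))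
      (fun i => by fun_prop) (fun i y => hC (y i)) _ _
  have hvar (N : ℕ) : ∫ y : Fin (N + 1) → X, (particleMean y f - ∫ x, f x ∂χ) ^ 2
      ∂(Measure.pi fun _ => χ) ≤ C ^ 2 * (1 / ((N : ℝ) + 1)) := by
    have := integral_sq_average_sub_le (ι := Fin (N + 1)) χ hf hC
    rw [Fintype.card_fin, Nat.cast_add, Nat.cast_one] at this
    rw [mul_one_div (C ^ 2)]
    simpa only [particleMean, Nat.cast_add, Nat.cast_one] using this
  have h0 : Tendsto (fun N : ℕ => C ^ 2 * (1 / ((N : ℝ) + 1))) atTop (𝓝 0) := by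
    simpa using tendsto_one_div_add_atTop_nhds_zero_nat.const_mul (C ^ 2)
  have h := tendstoInMeasure_zero_of_integral_sq_kernel_le
    (ψ := fun N _ y => particleMean y f - ∫ x, f x ∂χ) (b := fun N _ => C ^ 2 * (1 / ((N : ℝ) + 1)))
    (fun _ : ℕ => measurable_const) hY hlaw hm (fun N _ => hint N) (fun N _ => hvar N)
    (TendstoInMeasure.of_tendsto_const h0)
  simpa using h.continuousAt_comp_const (φ := fun t => t + ∫ x, f x ∂χ) (by fun_prop)

omit [IsProbabilityMeasure χ] in
theorem tendstoInMeasure_particleMean_sub (hg_meas : ∀ z, Measurable (g z))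
    (hg_pos : ∀ z x, 0 < g z x)
    (hsys : ∀ N, IsParticleSystem P M χ g z n (ξ N) (I N)) {m : ℕ} (hm : m < n)
    {f : X → ℝ} (hf : Measurable f) (hfb : ∃ C, ∀ x, |f x| ≤ C) :
    TendstoInMeasure P (fun N ω => particleMean (fun i => ξ N (m + 1) i ω) f -
      particleMean (fun i => ξ N m i ω) (backward M (g (z m)) f) /
        particleMean (fun i => ξ N m i ω) (g (z m))) atTop fun _ => 0 := by
  obtain ⟨C, hC⟩ := hfb
  have hprob (N : ℕ) := isProbabilityMeasure_offspringLaw (N := N + 1) M (hg_pos (z m))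
  have hb := measurable_backward M (hg_meas (z m)) hf
  have hψ (N : ℕ) : Measurable fun p : (Fin (N + 1) → Fin (N + 1) × X) ×
      (Fin (N + 1) → Fin (N + 1) × X) => particleMean (fun i => (p.2 i).2) f -
      particleMean (fun i => (p.1 i).2) (backward M (g (z m)) f) /
        particleMean (fun i => (p.1 i).2) (g (z m)) :=
    ((measurable_particleMean hf).comp measurable_snd).sub
      (((measurable_particleMean hb).comp measurable_fst).div
        ((measurable_particleMean (hg_meas (z m))).comp measurable_fst))
  have hint (N : ℕ) (s : Fin (N + 1) → Fin (N + 1) × X) :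
      Integrable (fun y : Fin (N + 1) → Fin (N + 1) × X => (particleMean (fun i => (y i).2) f -
        particleMean (fun i => (s i).2) (backward M (g (z m)) f) /
          particleMean (fun i => (s i).2) (g (z m))) ^ 2)
        (populationKernel M (hg_meas (z m)) (hg_pos (z m)) s) :=
    integrable_sq_const_mul_sum_sub Finset.univ
      (F := fun i (y : Fin (N + 1) → Fin (N + 1) × X) => f (y i).2)
      (fun i => by fun_prop) (fun i y => hC (y i).2) _ _
  have hvar (N : ℕ) (s : Fin (N + 1) → Fin (N + 1) × X) :
      ∫ y : Fin (N + 1) → Fin (N + 1) × X, (particleMean (fun i => (y i).2) f -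
        particleMean (fun i => (s i).2) (backward M (g (z m)) f) /
          particleMean (fun i => (s i).2) (g (z m))) ^ 2
        ∂(populationKernel M (hg_meas (z m)) (hg_pos (z m)) s) ≤
      C ^ 2 * (1 / ((N : ℝ) + 1)) := by
    have := integral_sq_average_sub_le (ι := Fin (N + 1)) (offspringLaw M (g (z m)) s)
      (f := fun p => f p.2) (by fun_prop) fun p => hC p.2
    rw [Fintype.card_fin, Nat.cast_add, Nat.cast_one,
      integral_snd_offspringLaw M (hg_pos (z m)) s hf hC] at this
    rw [populationKernel_apply, mul_one_div (C ^ 2)]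
    refine le_trans (le_of_eq ?_) this
    refine integral_congr_ae (ae_of_all _ fun y => ?_)
    simp only [particleMean, Nat.cast_add, Nat.cast_one]
  have h0 : Tendsto (fun N : ℕ => C ^ 2 * (1 / ((N : ℝ) + 1))) atTop (𝓝 0) := by
    simpa using tendsto_one_div_add_atTop_nhds_zero_nat.const_mul (C ^ 2)
  exact tendstoInMeasure_zero_of_integral_sq_kernel_le
    (ψ := fun N s y => particleMean (fun i => (y i).2) f -
      particleMean (fun i => (s i).2) (backward M (g (z m)) f) /
        particleMean (fun i => (s i).2) (g (z m)))
    (b := fun N _ => C ^ 2 * (1 / ((N : ℝ) + 1)))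
    -- Labels are irrelevant for empirical means, so the ancestor time is simply taken to be `m`.
    (fun N => (hsys N).measurable_lineage m hm.le)
    (fun N => (hsys N).measurable_lineage m (m := m + 1) hm)
    (fun N => (hsys N).map_lineage hg_meas hg_pos le_rfl hm) hψ hint hvar
    (TendstoInMeasure.of_tendsto_const h0)

omit [IsProbabilityMeasure P] in
theorem tendstoInMeasure_div {U V : ℕ → Ω → ℝ} {u v : ℝ}
    (hU : TendstoInMeasure P U atTop fun _ => u) (hV : TendstoInMeasure P V atTop fun _ => v)
    (hv : v ≠ 0) : TendstoInMeasure P (fun N ω => U N ω / V N ω) atTop fun _ => u / v :=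
  (hU.prodMk_const hV).continuousAt_comp_const (φ := fun p : ℝ × ℝ => p.1 / p.2)
    (continuousAt_fst.div continuousAt_snd hv)

omit [IsProbabilityMeasure P] in
theorem tendstoInMeasure_of_sub {U V : ℕ → Ω → ℝ} {v : ℝ}
    (hU : TendstoInMeasure P (fun N ω => U N ω - V N ω) atTop fun _ => 0)
    (hV : TendstoInMeasure P V atTop fun _ => v) : TendstoInMeasure P U atTop fun _ => v := by
  simpa using (hU.prodMk_const hV).continuousAt_comp_const (φ := fun p : ℝ × ℝ => p.1 + p.2)
    (by fun_prop)

omit [MeasurableSpace X] in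
theorem exists_abs_potential_le (hg_pos : ∀ z x, 0 < g z x)
    (hg_bdd : ∀ z, ∃ C : ℝ, ∀ x, g z x ≤ C) (w : Z) : ∃ C, ∀ x, |g w x| ≤ C := by
  obtain ⟨C, hC⟩ := hg_bdd w
  exact ⟨C, fun x => by simpa [abs_of_pos (hg_pos w x)] using hC x⟩

theorem tendstoInMeasure_particleMean (hg_meas : ∀ z, Measurable (g z))
    (hg_pos : ∀ z x, 0 < g z x) (hg_bdd : ∀ z, ∃ C : ℝ, ∀ x, g z x ≤ C)
    (hsys : ∀ N, IsParticleSystem P M χ g z n (ξ N) (I N)) {m : ℕ} (hm : m ≤ n)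
    {f : X → ℝ} (hf : Measurable f) (hfb : ∃ C, ∀ x, |f x| ≤ C) :
    TendstoInMeasure P (fun N ω => particleMean (fun i => ξ N m i ω) f) atTop
      fun _ => ∫ x, f x ∂(predictor M χ g z m) := by
  induction m generalizing f with
  | zero =>
    rw [predictor_zero]
    exact tendstoInMeasure_particleMean_zero hsys hf hfb
  | succ m ih =>
    rw [integral_predictor_succ M hg_meas hg_pos hg_bdd z χ m hf hfb]
    refine tendstoInMeasure_of_sub
      (tendstoInMeasure_particleMean_sub hg_meas hg_pos hsys hm hf hfb) ?_
    refine tendstoInMeasure_div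
      (ih (by lia) (measurable_backward M (hg_meas _) hf)
        (exists_abs_backward_le M (hg_pos _) (hg_bdd _) hfb))
      (ih (by lia) (hg_meas _) (exists_abs_potential_le hg_pos hg_bdd _)) ?_
    exact (integral_potential_predictor_pos M hg_meas hg_pos hg_bdd z χ m).ne'

-- Hypothesis `hw` controls the block sizes: it says that N times the probability that two offspring
-- share a label converges, which forces the conditional variance of the pair sum to 0.
omit [IsProbabilityMeasure χ] in
theorem tendstoInMeasure_offDiag_sub (hg_meas : ∀ z, Measurable (g z))
    (hg_pos : ∀ z x, 0 < g z x)
    (hsys : ∀ N, IsParticleSystem P M χ g z n (ξ N) (I N)) {ℓ m : ℕ} (hℓ : ℓ ≤ m) (hm : m < n)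
    {f : X → ℝ} (hf : Measurable f) (hfb : ∃ C, ∀ x, |f x| ≤ C) {w : ℝ}
    (hw : TendstoInMeasure P (fun N ω => blockVariance (lineage (ξ N) (I N) ℓ m ω) (g (z m)) /
        particleMean (fun i => ξ N m i ω) (g (z m)) ^ 2) atTop fun _ => w) :
    TendstoInMeasure P (fun (N : ℕ) ω =>
      1 / ((N : ℝ) + 1) * ∑ p ∈ Finset.univ.offDiag, blockProd Prod.fst
        (fun q : Fin (N + 1) × X => f q.2) (lineage (ξ N) (I N) ℓ (m + 1) ω p.1)
        (lineage (ξ N) (I N) ℓ (m + 1) ω p.2) -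
      (N : ℝ) / ((N : ℝ) + 1) *
        (blockVariance (lineage (ξ N) (I N) ℓ m ω) (backward M (g (z m)) f) /
          particleMean (fun i => ξ N m i ω) (g (z m)) ^ 2)) atTop fun _ => 0 := by
  obtain ⟨C, hC⟩ := hfb
  have hprob (N : ℕ) := isProbabilityMeasure_offspringLaw (N := N + 1) M (hg_pos (z m))
  have hK (N : ℕ) (p : Fin (N + 1) × Fin (N + 1)) : Measurable fun y : Fin (N + 1) →
      Fin (N + 1) × X => blockProd Prod.fst (fun q : Fin (N + 1) × X => f q.2) (y p.1) (y p.2) :=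
    (measurable_blockProd measurable_fst (hf.comp measurable_snd)).comp
      (f := fun s : Fin (N + 1) → Fin (N + 1) × X => (s p.1, s p.2)) (by fun_prop)
  let K : ∀ N : ℕ, Fin (N + 1) × Fin (N + 1) → (Fin (N + 1) → Fin (N + 1) × X) → ℝ :=
    fun N p y => blockProd Prod.fst (fun q : Fin (N + 1) × X => f q.2) (y p.1) (y p.2)
  let W : ∀ N : ℕ, (Fin (N + 1) → Fin (N + 1) × X) → ℝ := fun N s =>
    blockVariance s (g (z m)) / particleMean (fun i => (s i).2) (g (z m)) ^ 2
  let Θ : ∀ N : ℕ, (Fin (N + 1) → Fin (N + 1) × X) → ℝ := fun N s =>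
    blockVariance s (backward M (g (z m)) f) / particleMean (fun i => (s i).2) (g (z m)) ^ 2
  let ψ : ∀ N : ℕ, (Fin (N + 1) → Fin (N + 1) × X) → (Fin (N + 1) → Fin (N + 1) × X) → ℝ :=
    fun N s y => 1 / ((N : ℝ) + 1) * ∑ p ∈ Finset.univ.offDiag, K N p y -
      (N : ℝ) / ((N : ℝ) + 1) * Θ N s
  -- With N + 1 particles q₂ = W/(N + 1), hence (N + 1) q₃ ≤ W √(W/(N + 1)); inserted into the
  -- pair-sum bound, this is `b`.
  let b : ∀ N : ℕ, (Fin (N + 1) → Fin (N + 1) × X) → ℝ := fun N s =>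
    4 * C ^ 4 * (W N s * √(W N s * (1 / ((N : ℝ) + 1))) + W N s * (1 / ((N : ℝ) + 1)))
  have hψ (N : ℕ) : Measurable fun p : (Fin (N + 1) → Fin (N + 1) × X) ×
      (Fin (N + 1) → Fin (N + 1) × X) => ψ N p.1 p.2 := by
    refine Measurable.sub (measurable_const.mul (Finset.measurable_sum _ fun p _ =>
      (hK N p).comp measurable_snd)) (measurable_const.mul ?_)
    exact ((measurable_blockVariance (measurable_backward M (hg_meas (z m)) hf)).comp
      measurable_fst).div
        (((measurable_particleMean (hg_meas (z m))).comp measurable_fst).pow_const 2)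
  have hint (N : ℕ) (s : Fin (N + 1) → Fin (N + 1) × X) :
      Integrable (fun y => ψ N s y ^ 2)
        (populationKernel M (hg_meas (z m)) (hg_pos (z m)) s) :=
    integrable_sq_const_mul_sum_sub Finset.univ.offDiag (F := K N) (hK N)
      (fun p y => abs_blockProd_le (f := fun q : Fin (N + 1) × X => f q.2)
        (fun q => hC q.2) _ _) _ _
  have hvar (N : ℕ) (s : Fin (N + 1) → Fin (N + 1) × X) :
      ∫ y, ψ N s y ^ 2 ∂(populationKernel M (hg_meas (z m)) (hg_pos (z m)) s) ≤ b N s := by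
    have h1 := integral_sq_offDiag_le (ι := Fin (N + 1)) (offspringLaw M (g (z m)) s)
      (b := Prod.fst) (f := fun q : Fin (N + 1) × X => f q.2) measurable_fst
      (hf.comp measurable_snd) fun p => hC p.2
    have h2 := sum_pow_three_le fun e => (offspringLaw M (g (z m)) s).real (Prod.fst ⁻¹' {e})
    rw [sum_sq_setIntegral_offspringLaw M (hg_pos (z m)) s hf hC] at h1
    rw [sum_sq_measureReal_offspringLaw M (hg_pos (z m)) s] at h1 h2
    rw [Fintype.card_fin, Nat.cast_add, Nat.cast_one] at h1
    rw [Nat.cast_add, Nat.cast_one] at h2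
    have hN : (0 : ℝ) < (N : ℝ) + 1 := by positivity
    have h3 (t : ℝ) : ((N : ℝ) + 1 - 1) * (t / ((N : ℝ) + 1)) = (N : ℝ) / ((N : ℝ) + 1) * t := by
      field_simp
      ring
    rw [h3] at h1
    refine h1.trans ?_
    have hC4 : 0 ≤ 4 * C ^ 4 := by positivity
    refine mul_le_mul_of_nonneg_left (add_le_add ?_ (by rw [mul_one_div])) hC4
    refine (mul_le_mul_of_nonneg_left h2 hN.le).trans (le_of_eq ?_)
    rw [mul_one_div, ← mul_assoc, mul_div_cancel₀ _ hN.ne']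
  have hlim : TendstoInMeasure P (fun N ω => b N (lineage (ξ N) (I N) ℓ m ω)) atTop
      fun _ => 0 := by
    have h1 : TendstoInMeasure P (fun (N : ℕ) (_ : Ω) => 1 / ((N : ℝ) + 1)) atTop fun _ => 0 :=
      TendstoInMeasure.of_tendsto_const tendsto_one_div_add_atTop_nhds_zero_nat
    have h2 := (hw.prodMk_const h1).continuousAt_comp_const
      (φ := fun p : ℝ × ℝ => 4 * C ^ 4 * (p.1 * √(p.1 * p.2) + p.1 * p.2)) (by fun_prop)
    simp only [mul_zero, Real.sqrt_zero, add_zero] at h2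
    exact h2
  exact tendstoInMeasure_zero_of_integral_sq_kernel_le (ψ := ψ) (b := b)
    (fun N => (hsys N).measurable_lineage ℓ hm.le)
    (fun N => (hsys N).measurable_lineage ℓ (m := m + 1) hm)
    (fun N => (hsys N).map_lineage hg_meas hg_pos hℓ hm) hψ hint hvar hlim

theorem enoch_self {N : ℕ} (J : ℕ → Fin N → Fin N) (m : ℕ) (i : Fin N) : enoch J m m i = i := by
  cases m <;> simp [enoch]

/-- Induction on `m` for all bounded `f` at once, since the step uses the hypothesis for two other
functions: the potential, for concentration, and `backward M (g (z m)) f`, for the conditional mean.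
-/
theorem tendstoInMeasure_blockVariance (hg_meas : ∀ z, Measurable (g z))
    (hg_pos : ∀ z x, 0 < g z x) (hg_bdd : ∀ z, ∃ C : ℝ, ∀ x, g z x ≤ C)
    (hsys : ∀ N, IsParticleSystem P M χ g z n (ξ N) (I N)) {ℓ m : ℕ} (hℓ : ℓ ≤ m) (hm : m ≤ n)
    {f : X → ℝ} (hf : Measurable f) (hfb : ∃ C, ∀ x, |f x| ≤ C) :
    TendstoInMeasure P (fun N ω => blockVariance (lineage (ξ N) (I N) ℓ m ω) f) atTop
      fun _ => limitVariance M z χ g m ℓ f := by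
  have hsq {f : X → ℝ} (hfb : ∃ C, ∀ x, |f x| ≤ C) : ∃ C, ∀ x, |f x ^ 2| ≤ C := by
    obtain ⟨C, hC⟩ := hfb
    exact ⟨C ^ 2, fun x => by rw [abs_pow]; exact pow_le_pow_left₀ (abs_nonneg _) (hC x) 2⟩
  induction m, hℓ using Nat.le_induction generalizing f with
  | base =>
    rw [limitVariance_self M hg_meas hg_pos hg_bdd z χ ℓ hf]
    have h := tendstoInMeasure_particleMean hg_meas hg_pos hg_bdd hsys hm (hf.pow_const 2)
      (hsq hfb)
    refine h.congr_left fun N => ae_of_all _ fun ω => ?_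
    -- At time ℓ every particle is its own ancestor, so blocks are singletons and only the squares
    -- remain.
    simp [blockVariance, particleMean, lineage, enoch_self, Finset.sum_filter]
  | succ m hℓ ih =>
    have hpos := integral_potential_predictor_pos M hg_meas hg_pos hg_bdd z χ m
    have hpot := exists_abs_potential_le hg_pos hg_bdd (z m)
    have hden : TendstoInMeasure P (fun N ω => particleMean (fun i => ξ N m i ω) (g (z m)) ^ 2)
        atTop fun _ => (∫ x, g (z m) x ∂(predictor M χ g z m)) ^ 2 :=
      (tendstoInMeasure_particleMean hg_meas hg_pos hg_bdd hsys (by lia) (hg_meas (z m))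
        hpot).continuousAt_comp_const (φ := fun t : ℝ => t ^ 2) (by fun_prop)
    have hw := tendstoInMeasure_div (ih (by lia) (hg_meas (z m)) hpot) hden (by positivity)
    have hb := tendstoInMeasure_div (ih (by lia) (measurable_backward M (hg_meas (z m)) hf)
      (exists_abs_backward_le M (hg_pos _) (hg_bdd _) hfb)) hden (by positivity)
    have hone : TendstoInMeasure P (fun (N : ℕ) (_ : Ω) => (N : ℝ) / ((N : ℝ) + 1)) atTop
        fun _ => 1 :=
      TendstoInMeasure.of_tendsto_const (tendsto_natCast_div_add_atTop (1 : ℝ))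
    have hcond := (hone.prodMk_const hb).continuousAt_comp_const
      (φ := fun p : ℝ × ℝ => p.1 * p.2) (by fun_prop)
    have hoff := tendstoInMeasure_of_sub
      (tendstoInMeasure_offDiag_sub hg_meas hg_pos hsys hℓ hm hf hfb hw) hcond
    have hdiag := tendstoInMeasure_particleMean hg_meas hg_pos hg_bdd hsys hm (hf.pow_const 2)
      (hsq hfb)
    have hsum := (hdiag.prodMk_const hoff).continuousAt_comp_const
      (φ := fun p : ℝ × ℝ => p.1 + p.2) (by fun_prop)
    rw [limitVariance_succ M hg_meas hg_pos hg_bdd z χ hℓ hf hfb]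
    simp only [one_mul] at hsum
    refine hsum.congr_left fun N => ae_of_all _ fun ω => ?_
    simp only [blockVariance_eq, Nat.cast_add, Nat.cast_one]
    rfl

end convergence

end SMC

/-! ### From the limiting centring to the empirical one. -/

theorem proposition1 {X Z Ω : Type*} [MeasurableSpace X] [MeasurableSpace Ω]
    (P : Measure Ω) [IsProbabilityMeasure P]
    (M : Kernel X X) [IsMarkovKernel M] (χ : Measure X) [IsProbabilityMeasure χ]
    (g : Z → X → ℝ) (hg_meas : ∀ z, Measurable (g z))
    (hg_pos : ∀ z x, 0 < g z x) (hg_bdd : ∀ z, ∃ C : ℝ, ∀ x, g z x ≤ C)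
    (n : ℕ) (z : ℕ → Z) (lag : ℕ)
    (h : X → ℝ) (hh_meas : Measurable h) (hh_bdd : ∃ C : ℝ, ∀ x, |h x| ≤ C)
    (ξ : (N : ℕ) → ℕ → Fin N → Ω → X) (I : (N : ℕ) → ℕ → Fin N → Ω → Fin N)
    (hsys : ∀ N : ℕ, 1 ≤ N → SMC.IsParticleSystem P M χ g z n (ξ N) (I N)) :
    TendstoInMeasure P
      (fun (N : ℕ) (ω : Ω) =>
        SMC.fixedLagEstimator (fun m i => ξ N m i ω) (fun m i => I N m i ω) n lag h)
      atTop
      (fun _ => SMC.asymptoticVariance M χ g z n (n - lag) h) := by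
  -- Shifting to N + 1 particles makes the index types nonempty; the single value N = 0 does not
  -- affect the limit.
  suffices hs : TendstoInMeasure P
      (fun (N : ℕ) (ω : Ω) => SMC.fixedLagEstimator (fun m i => ξ (N + 1) m i ω)
        (fun m i => I (N + 1) m i ω) n lag h)
      atTop (fun _ => SMC.asymptoticVariance M χ g z n (n - lag) h) by
    intro ε hε
    exact (tendsto_add_atTop_iff_nat (f := fun N => P {ω | ε ≤ edist
      (SMC.fixedLagEstimator (fun m i => ξ N m i ω) (fun m i => I N m i ω) n lag h)
      (SMC.asymptoticVariance M χ g z n (n - lag) h)}) 1).1 (hs ε hε)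
  have hsys' (N : ℕ) := hsys (N + 1) (by lia)
  set c : ℝ := ∫ u, h u ∂(SMC.predictor M χ g z n) with hc
  have hbdd (d : ℝ) : ∃ C, ∀ x, |h x - c + d| ≤ C := by
    obtain ⟨C, hC⟩ := hh_bdd
    refine ⟨C + |c| + |d|, fun x => (abs_add_le _ _).trans ?_⟩
    gcongr
    exact (abs_sub _ _).trans (by gcongr; exact hC x)
  have hV {f : X → ℝ} (hf : Measurable f) (hfb : ∃ C, ∀ x, |f x| ≤ C) :=
    SMC.tendstoInMeasure_blockVariance (ξ := fun N => ξ (N + 1)) (I := fun N => I (N + 1))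
      hg_meas hg_pos hg_bdd hsys' (Nat.sub_le n lag) le_rfl hf hfb
  have hV0 := hV (f := fun x => h x - c) (by fun_prop) (by simpa using hbdd 0)
  have hV1 := hV (f := fun x => h x - c + 1) (by fun_prop) (hbdd 1)
  have hV2 := hV (f := fun _ => 1) measurable_const ⟨1, fun _ => by simp⟩
  have hmean := SMC.tendstoInMeasure_particleMean (ξ := fun N => ξ (N + 1))
    (I := fun N => I (N + 1)) hg_meas hg_pos hg_bdd hsys' le_rfl hh_meas hh_bdd
  have hcomb {U V : ℕ → Ω → ℝ} {u v : ℝ} (φ : ℝ → ℝ → ℝ)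
      (hφ : Continuous fun p : ℝ × ℝ => φ p.1 p.2) (hU : TendstoInMeasure P U atTop fun _ => u)
      (hV : TendstoInMeasure P V atTop fun _ => v) :
      TendstoInMeasure P (fun N ω => φ (U N ω) (V N ω)) atTop fun _ => φ u v :=
    (hU.prodMk_const hV).continuousAt_comp_const hφ.continuousAt
  -- The coefficients of the linear and quadratic corrections converge to finite constants, while
  -- the empirical mean minus `c` tends to 0; both corrections therefore vanish.
  have hlin := hcomb (fun u v => u - v) (by fun_prop)
    (hcomb (fun u v => u - v) (by fun_prop) hV1 hV0) hV2
  have h1 := hcomb (fun u v => (u - c) * v) (by fun_prop) hmean hlin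
  have h2 := hcomb (fun u v => (u - c) ^ 2 * v) (by fun_prop) hmean hV2
  have hlim := hcomb (fun u v => u + v) (by fun_prop)
    (hcomb (fun u v => u - v) (by fun_prop) hV0 h1) h2
  simp only [← hc, sub_self, zero_mul, sub_zero, ne_eq, OfNat.ofNat_ne_zero, not_false_eq_true,
    zero_pow, add_zero] at hlim
  refine hlim.congr_left fun N => ae_of_all _ fun ω => ?_
  -- Taken with f = h - c and d = (empirical mean) - c, so that f - d is `h` centred empirically.
  rw [← SMC.blockVariance_sub]
  simp only [sub_sub, add_sub_cancel]
  rfl
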